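/- Let $N=\{1,\dots,n\}$ be a set of $n\ge 1$ agents and $M$ a set of $m\ge 0$ indivisible items. Each agent $i$ has a valuation $v_i:2^{M}\to\mathbb{R}_{+}$ with $v_i(\emptyset)=0$ that is monotone ($v_i(A)\le v_i(B)$ for $A\subseteq B$) and submodular ($v_i(A\cup\{g\})-v_i(A)\ge v_i(B\cup\{g\})-v_i(B)$ for $A\subseteq B\subseteq M$ and $g\in M\setminus B$). An allocation is a partition $(A_1,\dots,A_n)$ of $M$ into $n$ possibly empty parts, and the maximin share of agent $i$ is $$\mathrm{MMS}_i=\max_{(P_1,\dots,P_n)}\ \min_{1\le k\le n} v_i(P_k),$$ the maximum being over all partitions of $M$ into $n$ possibly empty parts. There is a polynomial-time $\tfrac12\left(1-\tfrac1e-o(1)\right)$-approximation algorithm for maximin shares, in the value oracle model. That is, there are one (deterministic) algorithm, a polynomial $p$ and a sequence $\varepsilon(m)\to 0$ (as $m\to\infty$) such that for all $n\ge 1$, $m\ge 0$ and all valuations $v_1,\dots,v_n$ as above, the algorithm, given $n$, $m$ and access to the $v_i$ through value queries $(i,S)\mapsto v_i(S)$, halts after at most $p(n+m)$ steps and outputs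 an allocation $(A_1,\dots,A_n)$ with $$v_i(A_i)\ \ge\ \tfrac12\left(1-\tfrac1e-\varepsilon(m)\right)\mathrm{MMS}_i\qquad\text{for every agent } i .$$ Here an algorithm is a fixed finite while-program over arrays of integers and arrays of reals, whose steps are value queries, assignments (using integer addition and truncated subtraction and the four real arithmetic operations, with integers as the only constants, and computed array indices) and tests (comparisons of integers or of reals). The limiting factor is $\tfrac12(1-\tfrac1e)\approx 0.316$ (the two numbers differ by less than $0.0005$). -/

import Mathlib

open Filter Topology

namespace MMSAlloc

/-! ## Valuations, allocations and maximin shares -/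

/-- A normalized monotone submodular valuation on the item set `Fin m` (nonnegativity follows). -/
structure IsValuation {m : ℕ} (f : Finset (Fin m) → ℝ) : Prop where
  empty : f ∅ = 0
  mono : ∀ A B : Finset (Fin m), A ⊆ B → f A ≤ f B
  submodular : ∀ (A B : Finset (Fin m)) (g : Fin m), A ⊆ B → g ∉ B →
    f (insert g B) - f B ≤ f (insert g A) - f A

/-- An allocation of `m` items into `n` (possibly empty) parts is a map `Fin m → Fin n`;
`bundle A i` is its `i`-th part. -/
def bundle {m n : ℕ} (A : Fin m → Fin n) (i : Fin n) : Finset (Fin m) :=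
  Finset.univ.filter fun j => A j = i

/-- The maximin share for `n` agents of the valuation `f`: the maximum over all partitions of the
items into `n` parts of the value of the worst part. -/
noncomputable def mms {m : ℕ} (n : ℕ) (f : Finset (Fin m) → ℝ) : ℝ :=
  ⨆ P : Fin m → Fin n, ⨅ i : Fin n, f (bundle P i)

/-! ## Algorithms with value oracles

A program is a finite while-program over integer arrays and real arrays (a real random access
machine), which can ask for the value of a set of items to an agent. Arrays are named by natural
numbers; the index of an access may be computed. -/

/-- The memory: entry `k` of the integer array `a` is `nat a k`, entry `k` of the real array `a`
is `real a k`. -/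
structure State where
  nat : ℕ → ℕ → ℕ
  real : ℕ → ℕ → ℝ

/-- Integer expressions. There is no multiplication, so that the length of the integers stays
linear in the number of steps. -/
inductive NExp where
  | const (k : ℕ)
  | read (a : ℕ) (e : NExp)
  | add (e f : NExp)
  | sub (e f : NExp)

/-- Value of an integer expression (subtraction is truncated at `0`). -/
def NExp.eval (s : State) : NExp → ℕ
  | .const k => k
  | .read a e => s.nat a (e.eval s)
  | .add e f => e.eval s + f.eval s
  | .sub e f => e.eval s - f.eval s

/-- Real expressions. The only real constants are integers; there is no rounding. -/
inductive RExp where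
  | cast (e : NExp)
  | read (a : ℕ) (e : NExp)
  | add (x y : RExp)
  | sub (x y : RExp)
  | mul (x y : RExp)
  | div (x y : RExp)

/-- Value of a real expression (a division by `0` returns `0`). -/
noncomputable def RExp.eval (s : State) : RExp → ℝ
  | .cast e => (e.eval s : ℝ)
  | .read a e => s.real a (e.eval s)
  | .add x y => x.eval s + y.eval s
  | .sub x y => x.eval s - y.eval s
  | .mul x y => x.eval s * y.eval s
  | .div x y => x.eval s / y.eval s

/-- Tests: comparisons and their Boolean combinations. -/
inductive Test where
  | ltNat (e f : NExp)
  | ltReal (x y : RExp)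
  | not (b : Test)
  | and (b c : Test)

/-- Truth of a test. -/
def Test.Holds (s : State) : Test → Prop
  | .ltNat e f => e.eval s < f.eval s
  | .ltReal x y => x.eval s < y.eval s
  | .not b => ¬ b.Holds s
  | .and b c => b.Holds s ∧ c.Holds s

/-- Programs. -/
inductive Program where
  | skip
  | setNat (a : ℕ) (k : NExp) (e : NExp)
  | setReal (a : ℕ) (k : NExp) (x : RExp)
  | query (a : ℕ) (k : NExp) (i : NExp) (b : ℕ)
  | seq (c d : Program)
  | ite (b : Test) (c d : Program)
  | while (b : Test) (c : Program)

/-- Write `x` into entry `k` of the integer array `a`. -/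
def State.setNat (s : State) (a k x : ℕ) : State :=
  { s with nat := Function.update s.nat a (Function.update (s.nat a) k x) }

/-- Write `x` into entry `k` of the real array `a`. -/
noncomputable def State.setReal (s : State) (a k : ℕ) (x : ℝ) : State :=
  { s with real := Function.update s.real a (Function.update (s.real a) k x) }

/-- The answer to a value query: the value to agent `i` of the set of those items at which the
integer array `b` is nonzero (and `0` if there is no agent `i`). -/
noncomputable def answer {n m : ℕ} (v : Fin n → Finset (Fin m) → ℝ) (s : State) (i b : ℕ) : ℝ :=
  if h : i < n then v ⟨i, h⟩ (Finset.univ.filter fun j : Fin m => s.nat b j ≠ 0) else 0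

/-- `Runs v c s t s'`: with value oracle `v`, the program `c` started in memory `s` halts in memory
`s'` after exactly `t` steps. Every execution of an assignment, of a value query, of a test or of
`skip` is a step (the expressions in it are part of the program, so that their size is a
constant). -/
inductive Runs {n m : ℕ} (v : Fin n → Finset (Fin m) → ℝ) :
    Program → State → ℕ → State → Prop where
  | skip (s : State) : Runs v .skip s 1 s
  | setNat (s : State) (a : ℕ) (k e : NExp) :
      Runs v (.setNat a k e) s 1 (s.setNat a (k.eval s) (e.eval s))
  | setReal (s : State) (a : ℕ) (k : NExp) (x : RExp) :
      Runs v (.setReal a k x) s 1 (s.setReal a (k.eval s) (x.eval s))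
  | query (s : State) (a : ℕ) (k i : NExp) (b : ℕ) :
      Runs v (.query a k i b) s 1 (s.setReal a (k.eval s) (answer v s (i.eval s) b))
  | seq {c d : Program} {s s' s'' : State} {t t' : ℕ} :
      Runs v c s t s' → Runs v d s' t' s'' → Runs v (.seq c d) s (t + t') s''
  | ite_true {b : Test} {c d : Program} {s s' : State} {t : ℕ} :
      b.Holds s → Runs v c s t s' → Runs v (.ite b c d) s (t + 1) s'
  | ite_false {b : Test} {c d : Program} {s s' : State} {t : ℕ} :
      ¬ b.Holds s → Runs v d s t s' → Runs v (.ite b c d) s (t + 1) s'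
  | while_true {b : Test} {c : Program} {s s' s'' : State} {t t' : ℕ} :
      b.Holds s → Runs v c s t s' → Runs v (.while b c) s' t' s'' →
      Runs v (.while b c) s (t + t' + 1) s''
  | while_false {b : Test} {c : Program} {s : State} :
      ¬ b.Holds s → Runs v (.while b c) s 1 s

/-- The initial memory: integer array `0` starts with the number `n` of agents and the number `m`
of items, everything else is `0`. -/
def initial (n m : ℕ) : State where
  nat a k := if a = 0 then (if k = 0 then n else if k = 1 then m else 0) else 0
  real _ _ := 0

/-- `Outputs v c A t`: on the instance `v`, the program `c` halts after exactly `t` steps with the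
allocation `A` in its output array, the integer array `1`, entry `j` being the owner of item `j`. -/
def Outputs {n m : ℕ} (v : Fin n → Finset (Fin m) → ℝ) (c : Program) (A : Fin m → Fin n)
    (t : ℕ) : Prop :=
  ∃ s : State, Runs v c (initial n m) t s ∧ ∀ j : Fin m, s.nat 1 j = A j

end MMSAlloc

namespace MMSAlloc

/-! ## Submodular valuations -/

namespace IsValuation

variable {m : ℕ} {f : Finset (Fin m) → ℝ}

/-! A local search secures 19/60 of its maximin share for every agent, and 19/60 = 0.3166… exceeds
½(1 − 1/e) = 0.3160…, so no error term is needed. Each agent `i` has a threshold `τ i`, which starts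
above its share, and is satisfied once its bundle is worth `τ i / 3`. An unsatisfied agent locks an
unlocked item worth at least `τ i / 3` and retires with threshold 0; or takes an unlocked item whose
gain, in units of `τ i`, exceeds the owner's loss (values capped at 2/3 of the owner's threshold, in
units of it) by at least 2/(3(m+1)); or, if no item allows either, multiplies its threshold by
19/20.

Lowering is safe by `mms_lt_of_stuck`. If the share of a stuck agent were at least `τ i`, then in a
maximin partition the parts without locked items would be at least as many as the active agents, and
each would raise the normalized value of `i` by 2/3. By submodularity the gains of single items add
up to at least 2/3 per active agent, while the losses add up to at most 2/3 per active agent other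
than `i`. The surplus 2/3 is too large for `m` items of profit below 2/(3(m+1)). So an agent that
has not retired with a good item keeps a threshold of at least 19/20 of its share, and satisfaction
yields a third of that.

The search is short because `potential` lies in [0, 4n) and each step raises it by at least
1/(20(m+1)): see `potential_move`, `Inv.potential_lock` and `Inv.potential_lower`. For lowering, the
initial threshold must be within a factor `m` of the share; `IsStart`, `m` times the `n`-th largest
item value, achieves this.

A calculus of total correctness with step counts (`WP`) transfers this to the program; the main loop
is handled by `LoopInv` and `wp_body`. -/

theorem nonneg (hf : IsValuation f) (S : Finset (Fin m)) : 0 ≤ f S :=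
  hf.empty ▸ hf.mono ∅ S (Finset.empty_subset S)

/-- Add the items of `S` one at a time: submodularity bounds each increment by the increment over
`A` alone. -/
theorem union_sub_le (hf : IsValuation f) (A S : Finset (Fin m)) :
    f (A ∪ S) - f A ≤ ∑ g ∈ S, (f (insert g A) - f A) := by
  induction S using Finset.induction_on with
  | empty => simp
  | insert g S hg ih =>
    rw [Finset.sum_insert hg, Finset.union_insert]
    by_cases h : g ∈ A ∪ S
    · rw [Finset.insert_eq_self.2 h]
      have := hf.mono A (insert g A) (Finset.subset_insert _ _)
      linarith
    · have := hf.submodular A (A ∪ S) g Finset.subset_union_left h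
      linarith

theorem le_sum_singleton (hf : IsValuation f) (S : Finset (Fin m)) :
    f S ≤ ∑ g ∈ S, f {g} := by
  simpa [hf.empty] using hf.union_sub_le ∅ S

theorem insert_le_add (hf : IsValuation f) (A : Finset (Fin m)) (g : Fin m) :
    f (insert g A) ≤ f A + f {g} := by
  by_cases h : g ∈ A
  · rw [Finset.insert_eq_self.2 h]
    linarith [hf.nonneg {g}]
  · have := hf.submodular ∅ A g (Finset.empty_subset _) h
    simp only [hf.empty, insert_empty_eq] at this
    linarith

/-- Build `S` up item by item: each final loss is at most the increment when the item arrived, and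
these increments telescope. This bounds the total that an owner can lose over single removals. -/
theorem sum_erase_le (hf : IsValuation f) (S : Finset (Fin m)) :
    ∑ g ∈ S, (f S - f (S.erase g)) ≤ f S := by
  induction S using Finset.induction_on with
  | empty => simp [hf.empty]
  | insert g S hg ih =>
    rw [Finset.sum_insert hg, Finset.erase_insert hg]
    have : ∑ x ∈ S, (f (insert g S) - f ((insert g S).erase x))
        ≤ ∑ x ∈ S, (f S - f (S.erase x)) := by
      refine Finset.sum_le_sum fun x hx => ?_
      have hxg : g ≠ x := fun h => hg (h ▸ hx)
      have hxS : x ∉ insert g (S.erase x) := by simp [hxg.symm]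
      have := hf.submodular (S.erase x) (insert g (S.erase x)) x (Finset.subset_insert _ _) hxS
      rw [Finset.insert_comm, Finset.insert_erase hx] at this
      rwa [Finset.erase_insert_of_ne hxg]
    linarith

/-- Monotonicity matters beside submodularity: once the larger set reaches the cap its increment
vanishes, and below the cap the smaller set has at least as much room left. -/
theorem min_const (hf : IsValuation f) {c : ℝ} (hc : 0 ≤ c) :
    IsValuation fun S => min (f S) c where
  empty := by simp [hf.empty, hc]
  mono A B h := min_le_min_right c (hf.mono A B h)
  submodular A B g hAB hg := by
    have h₁ := hf.submodular A B g hAB hg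
    have h₂ := hf.mono A B hAB
    have h₃ := hf.mono A (insert g A) (Finset.subset_insert _ _)
    have h₄ := hf.mono B (insert g B) (Finset.subset_insert _ _)
    have h₅ := hf.mono (insert g A) (insert g B) (Finset.insert_subset_insert _ hAB)
    rcases min_cases (f A) c with h | h <;> rcases min_cases (f B) c with h' | h' <;>
      rcases min_cases (f (insert g A)) c with k | k <;>
      rcases min_cases (f (insert g B)) c with k' | k' <;> linarith

theorem div_const (hf : IsValuation f) {c : ℝ} (hc : 0 ≤ c) :
    IsValuation fun S => f S / c where
  empty := by simp [hf.empty]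
  mono A B h := div_le_div_of_nonneg_right (hf.mono A B h) hc
  submodular A B g hAB hg := by
    rw [← sub_div, ← sub_div]
    exact div_le_div_of_nonneg_right (hf.submodular A B g hAB hg) hc

end IsValuation

/-! ## Maximin shares -/

section mms

variable {m n : ℕ} {f : Finset (Fin m) → ℝ}

theorem exists_le_bundle (hn : 0 < n) (f : Finset (Fin m) → ℝ) :
    ∃ P : Fin m → Fin n, ∀ k, mms n f ≤ f (bundle P k) := by
  have : Nonempty (Fin n) := ⟨⟨0, hn⟩⟩
  obtain ⟨P, hP⟩ := exists_eq_ciSup_of_finite (f := fun P : Fin m → Fin n => ⨅ i, f (bundle P i))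
  exact ⟨P, fun k => (show mms n f = _ from hP.symm) ▸ ciInf_le (Set.finite_range _).bddBelow k⟩

theorem le_mms (hn : 0 < n) (P : Fin m → Fin n) {x : ℝ} (h : ∀ k, x ≤ f (bundle P k)) :
    x ≤ mms n f := by
  have : Nonempty (Fin n) := ⟨⟨0, hn⟩⟩
  exact (le_ciInf h).trans
    (le_ciSup (f := fun P : Fin m → Fin n => ⨅ i, f (bundle P i)) (Set.finite_range _).bddAbove P)

theorem mms_nonneg (hn : 0 < n) (hf : IsValuation f) : 0 ≤ mms n f :=
  le_mms hn (fun _ => ⟨0, hn⟩) fun _ => hf.nonneg _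

/-- The number of items worth at least as much as `g`. -/
noncomputable def rankOf (f : Finset (Fin m) → ℝ) (g : Fin m) : ℕ :=
  (Finset.univ.filter fun h : Fin m => f {g} ≤ f {h}).card

/-- Put `n` items that are each worth at least `g` into different parts; the remaining items may go
anywhere. -/
theorem singleton_le_mms (hn : 0 < n) (hf : IsValuation f) {g : Fin m} (hg : n ≤ rankOf f g) :
    f {g} ≤ mms n f := by
  have : Nonempty (Fin n) := ⟨⟨0, hn⟩⟩
  obtain ⟨S, hS, hc⟩ := Finset.exists_subset_card_eq hg
  let e : S ≃ Fin n := S.equivFinOfCardEq hc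
  refine le_mms hn (fun h => if hh : h ∈ S then e ⟨h, hh⟩ else ⟨0, hn⟩) fun k => ?_
  have hk := hS (e.symm k).2
  simp only [Finset.mem_filter, Finset.mem_univ, true_and] at hk
  refine hk.trans (hf.mono _ _ ?_)
  simp [bundle]

/-- By subadditivity each part of an optimal partition contains an item worth a fraction 1/m of the
share. These `n` items are distinct, so the cheapest of them has rank at least `n`. -/
theorem exists_mms_le_mul (hn : 0 < n) (hf : IsValuation f) (h0 : 0 < mms n f) :
    ∃ g : Fin m, n ≤ rankOf f g ∧ mms n f ≤ m * f {g} := by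
  obtain ⟨P, hP⟩ := exists_le_bundle hn f
  have key : ∀ k, ∃ g ∈ bundle P k, mms n f ≤ m * f {g} := by
    intro k
    by_contra! hk
    have hne : (bundle P k).Nonempty := by
      rw [Finset.nonempty_iff_ne_empty]
      intro h
      have := hP k
      rw [h, hf.empty] at this
      linarith
    have hm : 0 < (m : ℝ) := by
      obtain ⟨g, _⟩ := hne
      exact_mod_cast g.pos
    have h₁ : m * f (bundle P k) ≤ ∑ g ∈ bundle P k, m * f {g} := by
      rw [← Finset.mul_sum]
      exact mul_le_mul_of_nonneg_left (hf.le_sum_singleton _) hm.le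
    have h₂ := Finset.sum_lt_sum_of_nonempty hne hk
    have h₃ : ((bundle P k).card : ℝ) ≤ m := by
      exact_mod_cast (Finset.card_le_univ _).trans_eq (Fintype.card_fin m)
    rw [Finset.sum_const, nsmul_eq_mul] at h₂
    nlinarith [hP k, mul_le_mul_of_nonneg_right h₃ h0.le]
  choose G hG hG' using key
  have hinj : Function.Injective G := fun a b h => by
    have ha := hG a
    have hb := hG b
    simp only [bundle, Finset.mem_filter, Finset.mem_univ, true_and] at ha hb
    rw [← ha, ← hb, h]
  have : Nonempty (Fin n) := ⟨⟨0, hn⟩⟩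
  obtain ⟨k, hk⟩ := Finite.exists_min fun k => f {G k}
  refine ⟨G k, ?_, hG' k⟩
  calc n = (Finset.univ.image G).card := by
        rw [Finset.card_image_of_injective _ hinj, Finset.card_univ, Fintype.card_fin]
    _ ≤ _ := Finset.card_le_card fun h hh => by
        simp only [Finset.mem_image, Finset.mem_univ, true_and] at hh
        obtain ⟨l, rfl⟩ := hh
        simpa using hk l

/-- `x` is `m` times the value of the `n`-th most valuable item. -/
structure IsStart (n : ℕ) (f : Finset (Fin m) → ℝ) (x : ℝ) : Prop where
  attained : x = 0 ∨ ∃ g, n ≤ rankOf f g ∧ x = m * f {g}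
  upper : ∀ g, n ≤ rankOf f g → m * f {g} ≤ x
  nonneg : 0 ≤ x

theorem IsStart.mms_le {x : ℝ} (hx : IsStart n f x) (hn : 0 < n) (hf : IsValuation f) :
    mms n f ≤ x := by
  rcases (mms_nonneg hn hf).eq_or_lt with h | h
  · exact h ▸ hx.nonneg
  · obtain ⟨g, hg, hg'⟩ := exists_mms_le_mul hn hf h
    exact hg'.trans (hx.upper g hg)

theorem IsStart.le_mul_mms {x : ℝ} (hx : IsStart n f x) (hn : 0 < n) (hf : IsValuation f) :
    x ≤ m * mms n f := by
  rcases hx.attained with h | ⟨g, hg, h⟩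
  · rw [h]
    exact mul_nonneg (Nat.cast_nonneg _) (mms_nonneg hn hf)
  · rw [h]
    exact mul_le_mul_of_nonneg_left (singleton_le_mms hn hf hg) (Nat.cast_nonneg _)

end mms

/-! ## The local search -/

section search

variable {m n : ℕ}

/-- The truncated and normalized value of `S` at threshold `x`. -/
noncomputable def capped (f : Finset (Fin m) → ℝ) (x : ℝ) (S : Finset (Fin m)) : ℝ :=
  min (f S) (2 * x / 3) / x

theorem IsValuation.capped {f : Finset (Fin m) → ℝ} (hf : IsValuation f) {x : ℝ} (hx : 0 ≤ x) :
    IsValuation (capped f x) :=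
  (hf.min_const (by positivity)).div_const hx

theorem capped_le {f : Finset (Fin m) → ℝ} {x : ℝ} (hx : 0 ≤ x) (S : Finset (Fin m)) :
    capped f x S ≤ 2 / 3 := by
  rcases hx.eq_or_lt with rfl | h
  · norm_num [MMSAlloc.capped]
  · rw [MMSAlloc.capped, div_le_iff₀ h]
    exact (min_le_right _ _).trans_eq (by ring)

/-- Division by zero gives 0, so a retired agent counts for nothing and taking items from it costs
nothing. -/
theorem capped_zero (f : Finset (Fin m) → ℝ) (S : Finset (Fin m)) : capped f 0 S = 0 := by
  simp [capped]

/-- The improvement of the potential when item `g` moves to agent `i`. -/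
noncomputable def profit (v : Fin n → Finset (Fin m) → ℝ) (A : Fin m → Fin n) (τ : Fin n → ℝ) (i : Fin n) (g : Fin m) : ℝ :=
  (v i (insert g (bundle A i)) / τ i - v i (bundle A i) / τ i)
    - (capped (v (A g)) (τ (A g)) (bundle A (A g))
      - capped (v (A g)) (τ (A g)) ((bundle A (A g)).erase g))

/-- The averaging argument that justifies lowering a threshold: over the candidate items, total gain
minus total loss would be at least 2/3. -/
theorem mms_lt_of_stuck {v : Fin n → Finset (Fin m) → ℝ} (hv : ∀ i, IsValuation (v i)) {A : Fin m → Fin n} {τ : Fin n → ℝ} {L : Finset (Fin m)} {i : Fin n}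
    (hτ : ∀ j, 0 ≤ τ j)
    (hL : L.card + (Finset.univ.filter fun j => 0 < τ j).card ≤ n)
    (hi : 3 * v i (bundle A i) < τ i)
    (hp : ∀ g ∉ L, A g ≠ i → profit v A τ i g < 2 / (3 * (m + 1))) :
    mms n (v i) < τ i := by
  by_contra! hlt
  have hτi : 0 < τ i := lt_of_le_of_lt (mul_nonneg (by norm_num) ((hv i).nonneg _)) hi
  obtain ⟨P, hP⟩ := exists_le_bundle i.pos (v i)
  set T : Finset (Fin n) := Finset.univ.filter fun j => 0 < τ j with hT
  -- The parts of the maximin partition free of locked items; each locked item spoils at most one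
  -- part.
  set K : Finset (Fin n) := Finset.univ \ L.image P with hK
  set U : Finset (Fin m) := Finset.univ.filter fun g => g ∉ L ∧ A g ≠ i with hU
  have hiT : i ∈ T := by simp [hT, hτi]
  have hcard : (T.card : ℝ) ≤ K.card := by
    have h₁ : K.card = n - (L.image P).card := by
      rw [hK, Finset.card_sdiff_of_subset (Finset.subset_univ _), Finset.card_univ,
        Fintype.card_fin]
    have h₂ : (L.image P).card ≤ L.card := Finset.card_image_le
    exact_mod_cast (by omega : T.card ≤ K.card)
  have hgain : (K.card : ℝ) * (2 / 3)
      ≤ ∑ g ∈ U, (v i (insert g (bundle A i)) / τ i - v i (bundle A i) / τ i) := by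
    have hv' := (hv i).div_const hτi.le
    have h₁ : ∀ k ∈ K, (2 / 3 : ℝ)
        ≤ ∑ g ∈ bundle P k, (v i (insert g (bundle A i)) / τ i - v i (bundle A i) / τ i) := by
      intro k _
      refine le_trans ?_ (hv'.union_sub_le (bundle A i) (bundle P k))
      have h₂ := hv'.mono _ _ (Finset.subset_union_right (s₁ := bundle A i) (s₂ := bundle P k))
      have h₃ : 1 ≤ v i (bundle P k) / τ i := (one_le_div hτi).2 (hlt.trans (hP k))
      have h₄ : v i (bundle A i) / τ i ≤ 1 / 3 := by
        rw [div_le_iff₀ hτi]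
        linarith
      linarith
    have h₂ := Finset.sum_le_sum h₁
    rw [Finset.sum_const, nsmul_eq_mul] at h₂
    refine h₂.trans ?_
    have hnn : ∀ g, 0 ≤ v i (insert g (bundle A i)) / τ i - v i (bundle A i) / τ i := fun g =>
      sub_nonneg.2 (hv'.mono _ _ (Finset.subset_insert _ _))
    rw [← Finset.sum_biUnion]
    -- Outside `U`, these parts contain only items that `i` owns already, with gain 0.
    · have hz : ∀ g ∈ K.biUnion (bundle P), g ∉ U →
          v i (insert g (bundle A i)) / τ i - v i (bundle A i) / τ i = 0 := by
        intro g hg hgU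
        have hgL : g ∉ L := by
          intro h
          simp only [hK, bundle, Finset.mem_biUnion, Finset.mem_sdiff, Finset.mem_univ, true_and,
            Finset.mem_image, Finset.mem_filter] at hg
          obtain ⟨k, hk, rfl⟩ := hg
          exact hk ⟨g, h, rfl⟩
        have : g ∈ bundle A i := by
          simp only [hU, Finset.mem_filter, Finset.mem_univ, true_and, hgL, not_false_eq_true,
            ne_eq, not_not] at hgU
          simp [bundle, hgU]
        rw [Finset.insert_eq_self.2 this, sub_self]
      rw [← Finset.sum_filter_add_sum_filter_not (K.biUnion (bundle P)) (· ∈ U),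
        Finset.sum_eq_zero (s := Finset.filter (fun g => ¬ g ∈ U) _), add_zero]
      · exact Finset.sum_le_sum_of_subset_of_nonneg (fun g hg => (Finset.mem_filter.1 hg).2)
          fun g _ _ => hnn g
      · intro g hg
        exact hz g (Finset.mem_filter.1 hg).1 (Finset.mem_filter.1 hg).2
    · intro a _ b _ hab
      rw [Function.onFun, Finset.disjoint_left]
      intro g ha hb
      simp only [bundle, Finset.mem_filter, Finset.mem_univ, true_and] at ha hb
      exact hab (ha.symm.trans hb)
  -- Grouped by owner: each active agent other than `i` loses at most its capped value 2/3, and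
  -- retired agents lose nothing.
  have hloss : ∑ g ∈ U, (capped (v (A g)) (τ (A g)) (bundle A (A g))
      - capped (v (A g)) (τ (A g)) ((bundle A (A g)).erase g)) ≤ ((T.card : ℝ) - 1) * (2 / 3) := by
    have hnn : ∀ g, 0 ≤ capped (v (A g)) (τ (A g)) (bundle A (A g))
      - capped (v (A g)) (τ (A g)) ((bundle A (A g)).erase g) := fun g =>
        sub_nonneg.2 (((hv _).capped (hτ _)).mono _ _ (Finset.erase_subset _ _))
    calc _ ≤ ∑ g ∈ Finset.univ.filter (fun g => A g ≠ i),
          (capped (v (A g)) (τ (A g)) (bundle A (A g))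
            - capped (v (A g)) (τ (A g)) ((bundle A (A g)).erase g)) :=
          Finset.sum_le_sum_of_subset_of_nonneg (fun g hg => by
            simp only [hU, Finset.mem_filter, Finset.mem_univ, true_and] at hg ⊢
            exact hg.2) fun g _ _ => hnn g
      _ = ∑ j ∈ Finset.univ.erase i, ∑ g ∈ bundle A j, (capped (v j) (τ j) (bundle A j)
            - capped (v j) (τ j) ((bundle A j).erase g)) := by
          rw [← Finset.sum_fiberwise_of_maps_to (t := Finset.univ.erase i) (g := A)
            (fun g hg => by simpa using hg)]
          refine Finset.sum_congr rfl fun j hj => ?_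
          have : (Finset.univ.filter fun g => A g ≠ i).filter (fun g => A g = j) = bundle A j := by
            ext g
            simp only [bundle, Finset.mem_filter, Finset.mem_univ, true_and]
            refine ⟨fun h => h.2, fun h => ⟨?_, h⟩⟩
            rw [h]
            exact (Finset.mem_erase.1 hj).1
          rw [this]
          refine Finset.sum_congr rfl fun g hg => ?_
          have : A g = j := by simpa [bundle] using hg
          rw [this]
      _ ≤ ∑ j ∈ Finset.univ.erase i, capped (v j) (τ j) (bundle A j) :=
          Finset.sum_le_sum fun j _ => ((hv j).capped (hτ j)).sum_erase_le _
      _ ≤ ∑ j ∈ Finset.univ.erase i, if 0 < τ j then (2 / 3 : ℝ) else 0 := by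
          refine Finset.sum_le_sum fun j _ => ?_
          split_ifs with h
          · exact capped_le h.le _
          · rw [le_antisymm (not_lt.1 h) (hτ j), capped_zero]
      _ = ((T.card : ℝ) - 1) * (2 / 3) := by
          rw [← Finset.sum_filter, Finset.sum_const, nsmul_eq_mul, Finset.filter_erase,
            Finset.card_erase_of_mem hiT, Nat.cast_sub (Finset.card_pos.2 ⟨i, hiT⟩)]
          simp [hT]
  have htot : ∑ g ∈ U, profit v A τ i g ≤ m * (2 / (3 * (m + 1))) := by
    have h₁ : ∑ g ∈ U, profit v A τ i g ≤ ∑ _g ∈ U, (2 / (3 * (m + 1)) : ℝ) :=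
      Finset.sum_le_sum fun g hg => by
        simp only [hU, Finset.mem_filter, Finset.mem_univ, true_and] at hg
        exact (hp g hg.1 hg.2).le
    rw [Finset.sum_const, nsmul_eq_mul] at h₁
    refine h₁.trans (mul_le_mul_of_nonneg_right ?_ (by positivity))
    exact_mod_cast (Finset.card_le_univ _).trans_eq (Fintype.card_fin m)
  -- Having `m + 1` in the denominator makes this strict, also for `m = 0`.
  have hfin : (m : ℝ) * (2 / (3 * (m + 1))) < 2 / 3 := by
    rw [mul_div_assoc', div_lt_div_iff₀ (by positivity) (by norm_num)]
    linarith
  simp only [profit, Finset.sum_sub_distrib] at htot hgain hloss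
  nlinarith

/-- The invariant of the local search, for owners `A`, thresholds `τ` and locked items `L`. -/
structure Inv (v : Fin n → Finset (Fin m) → ℝ) (τ₀ : Fin n → ℝ) (A : Fin m → Fin n)
    (τ : Fin n → ℝ) (L : Finset (Fin m)) : Prop where
  nonneg : ∀ j, 0 ≤ τ j
  le_start : ∀ j, τ j ≤ τ₀ j
  card : L.card + (Finset.univ.filter fun j => 0 < τ j).card ≤ n
  good : ∀ j, 19 / 20 * mms n (v j) ≤ τ j ∨ ∃ g ∈ L, A g = j ∧ 19 / 60 * mms n (v j) ≤ v j {g}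

/-- The potential of the local search. -/
noncomputable def potential (v : Fin n → Finset (Fin m) → ℝ) (τ₀ : Fin n → ℝ) (A : Fin m → Fin n)
    (τ : Fin n → ℝ) (L : Finset (Fin m)) : ℝ :=
  ∑ j, (capped (v j) (τ j) (bundle A j) + (1 - τ j / τ₀ j)) + 2 * L.card

/-! ### Effect of the three steps on the invariant and the potential -/

variable {v : Fin n → Finset (Fin m) → ℝ} {τ₀ : Fin n → ℝ} {A : Fin m → Fin n}
  {τ : Fin n → ℝ} {L : Finset (Fin m)}

theorem Inv.potential_nonneg (h : Inv v τ₀ A τ L) (hv : ∀ i, IsValuation (v i)) :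
    0 ≤ potential v τ₀ A τ L := by
  refine add_nonneg (Finset.sum_nonneg fun j _ => add_nonneg ?_ ?_) (by positivity)
  · exact ((hv j).capped (h.nonneg j)).nonneg _
  · exact sub_nonneg.2 (div_le_one_of_le₀ (h.le_start j) ((h.nonneg j).trans (h.le_start j)))

theorem Inv.potential_lt (h : Inv v τ₀ A τ L) (hn : 0 < n) :
    potential v τ₀ A τ L < 4 * n := by
  -- Each agent contributes at most 2/3 + 1 and the at most `n` locked items 2 each, so the total is
  -- at most 11n/3.
  have h₁ : ∑ j, (capped (v j) (τ j) (bundle A j) + (1 - τ j / τ₀ j)) ≤ ∑ _j : Fin n, (5 / 3 : ℝ) :=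
    Finset.sum_le_sum fun j _ => by
      have := capped_le (f := v j) (h.nonneg j) (bundle A j)
      have := div_nonneg (h.nonneg j) ((h.nonneg j).trans (h.le_start j))
      linarith
  have h₂ : (L.card : ℝ) ≤ n := by exact_mod_cast (Nat.le_add_right _ _).trans h.card
  have h₃ : (0 : ℝ) < n := by exact_mod_cast hn
  rw [Finset.sum_const, Finset.card_univ, Fintype.card_fin, nsmul_eq_mul] at h₁
  rw [potential]
  linarith

theorem Inv.approx (h : Inv v τ₀ A τ L) (hv : ∀ i, IsValuation (v i))
    (hs : ∀ j, τ j ≤ 3 * v j (bundle A j)) (j : Fin n) :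
    19 / 60 * mms n (v j) ≤ v j (bundle A j) := by
  rcases h.good j with hj | ⟨g, -, hg, hj⟩
  · linarith [hs j]
  · exact hj.trans ((hv j).mono _ _ (by simp [bundle, hg]))

theorem bundle_update_self (A : Fin m → Fin n) (g : Fin m) (i : Fin n) :
    bundle (Function.update A g i) i = insert g (bundle A i) := by
  ext x
  by_cases h : x = g <;> simp [bundle, Function.update_apply, h]

theorem bundle_update_of_ne (A : Fin m → Fin n) (g : Fin m) {i j : Fin n} (h : j ≠ i) :
    bundle (Function.update A g i) j = (bundle A j).erase g := by
  ext x
  by_cases hx : x = g <;> simp [bundle, Function.update_apply, hx, h.symm]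

theorem erase_bundle_of_ne {A : Fin m → Fin n} {g : Fin m} {j : Fin n} (h : A g ≠ j) :
    (bundle A j).erase g = bundle A j :=
  Finset.erase_eq_of_notMem (by simp [bundle, h])

theorem Inv.move (h : Inv v τ₀ A τ L) {i : Fin n} {g : Fin m} (hg : g ∉ L) :
    Inv v τ₀ (Function.update A g i) τ L where
  nonneg := h.nonneg
  le_start := h.le_start
  card := h.card
  good j := (h.good j).imp_right fun ⟨x, hx, hA, hj⟩ =>
    ⟨x, hx, by rwa [Function.update_of_ne (ne_of_mem_of_not_mem hx hg)], hj⟩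

/-- Bundle and item are each worth less than `τ i / 3`, so the cap at 2/3 does not bind for `i`
before or after the move, and the uncapped gain in `profit` is exact. Only `i` and the old owner
change. -/
theorem potential_move (hv : ∀ i, IsValuation (v i)) {i : Fin n}
    {g : Fin m} (hi : 3 * v i (bundle A i) < τ i) (hgi : 3 * v i {g} < τ i) (hA : A g ≠ i) :
    potential v τ₀ (Function.update A g i) τ L = potential v τ₀ A τ L + profit v A τ i g := by
  have hself : ∀ S, v i S ≤ 2 * τ i / 3 → capped (v i) (τ i) S = v i S / τ i := fun S hS => by
    rw [capped, min_eq_left hS]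
  have h₁ := (hv i).insert_le_add (bundle A i) g
  have h₂ := (hv i).nonneg {g}
  simp only [potential, profit]
  have split : ∀ F : Fin n → ℝ,
      ∑ j, F j = F i + (F (A g) + ∑ j ∈ (Finset.univ.erase i).erase (A g), F j) := fun F => by
    rw [Finset.add_sum_erase _ F (Finset.mem_erase.2 ⟨hA, Finset.mem_univ (A g)⟩),
      Finset.add_sum_erase _ F (Finset.mem_univ i)]
  rw [split, split,
    bundle_update_self, bundle_update_of_ne _ _ hA, hself _ (by linarith), hself _ (by linarith)]
  have : ∀ j ∈ (Finset.univ.erase i).erase (A g),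
      capped (v j) (τ j) (bundle (Function.update A g i) j) + (1 - τ j / τ₀ j)
        = capped (v j) (τ j) (bundle A j) + (1 - τ j / τ₀ j) := fun j hj => by
    simp only [Finset.mem_erase, Finset.mem_univ, and_true] at hj
    rw [bundle_update_of_ne _ _ hj.2, erase_bundle_of_ne hj.1.symm]
  rw [Finset.sum_congr rfl this]
  ring

/-- One active agent is traded for one locked item, which keeps the count; the guarantee of `i`
passes from its threshold to the item. -/
theorem Inv.lock (h : Inv v τ₀ A τ L) {i : Fin n} {g : Fin m} (hg : g ∉ L)
    (hi : 0 < τ i) (hgi : τ i ≤ 3 * v i {g}) :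
    Inv v τ₀ (Function.update A g i) (Function.update τ i 0) (insert g L) where
  nonneg j := by
    rw [Function.update_apply]
    split_ifs
    exacts [le_rfl, h.nonneg j]
  le_start j := by
    rw [Function.update_apply]
    split_ifs
    exacts [(h.nonneg j).trans (h.le_start j), h.le_start j]
  card := by
    have : (Finset.univ.filter fun j => 0 < Function.update τ i 0 j)
        = (Finset.univ.filter fun j => 0 < τ j).erase i := by
      ext j
      by_cases hj : j = i <;> simp [Function.update_apply, hj]
    have hmem : i ∈ Finset.univ.filter fun j => 0 < τ j := by simp [hi]
    rw [this, Finset.card_insert_of_notMem hg, Finset.card_erase_of_mem hmem]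
    have := Finset.card_pos.2 ⟨i, hmem⟩
    have := h.card
    omega
  good j := by
    rcases h.good j with hj | ⟨x, hx, hA, hj⟩
    · by_cases hji : j = i
      · subst hji
        exact Or.inr ⟨g, Finset.mem_insert_self _ _, by simp, by linarith⟩
      · left
        rwa [Function.update_of_ne hji]
    · exact Or.inr ⟨x, Finset.mem_insert_of_mem hx,
        by rwa [Function.update_of_ne (ne_of_mem_of_not_mem hx hg)], hj⟩

/-- The weight 2 of a locked item pays for the capped values lost by `i` and by the old owner, at
most 2/3 each. -/
theorem Inv.potential_lock (h : Inv v τ₀ A τ L) (hv : ∀ i, IsValuation (v i)) {i : Fin n}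
    {g : Fin m} (hg : g ∉ L) :
    potential v τ₀ A τ L + 2 / 3
      ≤ potential v τ₀ (Function.update A g i) (Function.update τ i 0) (insert g L) := by
  have key : ∀ j, capped (v j) (τ j) (bundle A j) + (1 - τ j / τ₀ j)
      ≤ capped (v j) (Function.update τ i 0 j) (bundle (Function.update A g i) j)
        + (1 - Function.update τ i 0 j / τ₀ j)
        + ((if j = i then (2 / 3 : ℝ) else 0) + if j = A g then (2 / 3 : ℝ) else 0) := by
    intro j
    have h₁ := capped_le (f := v j) (h.nonneg j) (bundle A j)
    have h₂ := div_nonneg (h.nonneg j) ((h.nonneg j).trans (h.le_start j))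
    by_cases hji : j = i
    · subst hji
      rw [Function.update_self, capped_zero, if_pos rfl, zero_div]
      split_ifs <;> linarith
    · rw [Function.update_of_ne hji, if_neg hji, bundle_update_of_ne _ _ hji]
      by_cases hjA : j = A g
      · rw [if_pos hjA]
        have := ((hv j).capped (h.nonneg j)).nonneg ((bundle A j).erase g)
        linarith
      · rw [if_neg hjA, erase_bundle_of_ne (Ne.symm hjA)]
        linarith
  have hsum := Finset.sum_le_sum fun j (_ : j ∈ Finset.univ) => key j
  rw [Finset.sum_add_distrib (g := fun j => (_ + _ : ℝ)), Finset.sum_add_distrib,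
    Finset.sum_add_distrib (f := fun j => if j = i then (2 / 3 : ℝ) else 0)] at hsum
  simp only [Finset.sum_ite_eq', Finset.mem_univ, if_true] at hsum
  rw [potential, potential, Finset.card_insert_of_notMem hg]
  simp only [Finset.sum_add_distrib] at hsum ⊢
  push_cast
  linarith

theorem Inv.lower (h : Inv v τ₀ A τ L) {i : Fin n} (hi : mms n (v i) < τ i) (hi0 : 0 < τ i) :
    Inv v τ₀ A (Function.update τ i (19 / 20 * τ i)) L where
  nonneg j := by
    rw [Function.update_apply]
    split_ifs
    exacts [by positivity, h.nonneg j]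
  le_start j := by
    rw [Function.update_apply]
    split_ifs with hj
    · subst hj
      linarith [h.le_start j]
    · exact h.le_start j
  card := by
    have : (Finset.univ.filter fun j => 0 < Function.update τ i (19 / 20 * τ i) j)
        = Finset.univ.filter fun j => 0 < τ j := by
      ext j
      by_cases hj : j = i <;> simp [Function.update_apply, hj]
    rw [this]
    exact h.card
  good j := by
    by_cases hj : j = i
    · subst hj
      left
      rw [Function.update_self]
      linarith
    · rw [Function.update_of_ne hj]
      exact h.good j

/-- Capped value relative to the threshold cannot fall when the threshold falls. The other term
gains `τ i / (20 τ₀ i)`, where `τ i` exceeds the share and `τ₀ i` is at most `m` times the share. -/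
theorem Inv.potential_lower (h : Inv v τ₀ A τ L) (hv : ∀ i, IsValuation (v i)) {i : Fin n}
    (hi : mms n (v i) < τ i) (hi0 : 0 < τ i) (hs : τ₀ i ≤ m * mms n (v i)) :
    potential v τ₀ A τ L + 1 / (20 * (m + 1))
      ≤ potential v τ₀ A (Function.update τ i (19 / 20 * τ i)) L := by
  have split : ∀ F : Fin n → ℝ, ∑ j, F j = F i + ∑ j ∈ Finset.univ.erase i, F j := fun F =>
    (Finset.add_sum_erase _ F (Finset.mem_univ i)).symm
  rw [potential, potential, split, split, Function.update_self]
  have : ∀ j ∈ Finset.univ.erase i,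
      capped (v j) (Function.update τ i (19 / 20 * τ i) j) (bundle A j)
          + (1 - Function.update τ i (19 / 20 * τ i) j / τ₀ j)
        = capped (v j) (τ j) (bundle A j) + (1 - τ j / τ₀ j) := fun j hj => by
    rw [Function.update_of_ne (Finset.mem_erase.1 hj).1]
  rw [Finset.sum_congr rfl this]
  have h₀ : 0 < τ₀ i := hi0.trans_le (h.le_start i)
  have h₁ : capped (v i) (τ i) (bundle A i) ≤ capped (v i) (19 / 20 * τ i) (bundle A i) := by
    have hx := (hv i).nonneg (bundle A i)
    rw [capped, capped, div_le_div_iff₀ hi0 (by positivity)]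
    rcases min_cases (v i (bundle A i)) (2 * τ i / 3) with k | k <;>
      rcases min_cases (v i (bundle A i)) (2 * (19 / 20 * τ i) / 3) with k' | k' <;>
      rw [k.1, k'.1] <;> nlinarith
  have h₂ : (1 : ℝ) / (20 * (m + 1)) ≤ τ i / τ₀ i - 19 / 20 * τ i / τ₀ i := by
    rw [← sub_div, div_le_div_iff₀ (by positivity) h₀]
    have : (0 : ℝ) ≤ m := Nat.cast_nonneg m
    nlinarith [mul_le_mul_of_nonneg_left hi.le this]
  linarith

theorem Inv.start (hn : 0 < n) (hv : ∀ i, IsValuation (v i))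
    (hs : ∀ j, IsStart n (v j) (τ₀ j)) : Inv v τ₀ A τ₀ ∅ where
  nonneg j := (hs j).nonneg
  le_start _ := le_rfl
  card := by simpa using Finset.card_filter_le (Finset.univ : Finset (Fin n)) (fun j => 0 < τ₀ j)
  good j := Or.inl (by linarith [(hs j).mms_le hn (hv j), mms_nonneg hn (hv j)])

end search

/-! ## Total correctness with time -/

section logic

variable {m n : ℕ} (v : Fin n → Finset (Fin m) → ℝ)

/-- `c`, started in `s`, halts after some number `t` of steps in a memory `s'` with `Q t s'`. -/
def WP (c : Program) (s : State) (Q : ℕ → State → Prop) : Prop :=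
  ∃ t s', Runs v c s t s' ∧ Q t s'

variable {v}

theorem WP.mono {c : Program} {s : State} {Q Q' : ℕ → State → Prop} (h : WP v c s Q)
    (hQ : ∀ t s', Q t s' → Q' t s') : WP v c s Q' := by
  obtain ⟨t, s', hr, hq⟩ := h
  exact ⟨t, s', hr, hQ t s' hq⟩

theorem wp_skip {s : State} {Q : ℕ → State → Prop} (h : Q 1 s) : WP v .skip s Q :=
  ⟨_, _, .skip s, h⟩

theorem wp_setNat {s : State} {a : ℕ} {k e : NExp} {Q : ℕ → State → Prop}
    (h : Q 1 (s.setNat a (k.eval s) (e.eval s))) : WP v (.setNat a k e) s Q :=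
  ⟨_, _, .setNat s a k e, h⟩

theorem wp_setReal {s : State} {a : ℕ} {k : NExp} {x : RExp} {Q : ℕ → State → Prop}
    (h : Q 1 (s.setReal a (k.eval s) (x.eval s))) : WP v (.setReal a k x) s Q :=
  ⟨_, _, .setReal s a k x, h⟩

theorem wp_query {s : State} {a b : ℕ} {k i : NExp} {Q : ℕ → State → Prop}
    (h : Q 1 (s.setReal a (k.eval s) (answer v s (i.eval s) b))) :
    WP v (.query a k i b) s Q :=
  ⟨_, _, .query s a k i b, h⟩

theorem wp_seq {s : State} {c d : Program} {Q : ℕ → State → Prop}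
    (h : WP v c s fun t s' => WP v d s' fun t' => Q (t + t')) : WP v (.seq c d) s Q := by
  obtain ⟨t, s', hr, t', s'', hr', hq⟩ := h
  exact ⟨_, _, .seq hr hr', hq⟩

theorem wp_ite {s : State} {b : Test} {c d : Program} {Q : ℕ → State → Prop}
    (h₁ : b.Holds s → WP v c s fun t => Q (t + 1))
    (h₂ : ¬ b.Holds s → WP v d s fun t => Q (t + 1)) : WP v (.ite b c d) s Q := by
  by_cases hb : b.Holds s
  · obtain ⟨t, s', hr, hq⟩ := h₁ hb
    exact ⟨_, _, .ite_true hb hr, hq⟩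
  · obtain ⟨t, s', hr, hq⟩ := h₂ hb
    exact ⟨_, _, .ite_false hb hr, hq⟩

/-- The number in the invariant is a rank that bounds the remaining rounds. A round costs the body
and one test; the final 1 is the failing test. -/
theorem wp_while {b : Test} {c : Program} (I : ℕ → State → Prop) (T : ℕ)
    (hstep : ∀ N s, I N s → b.Holds s → WP v c s fun t s' => t ≤ T ∧ ∃ N' < N, I N' s')
    {N : ℕ} {s : State} (h : I N s) :
    WP v (.while b c) s fun t s' => t ≤ N * (T + 1) + 1 ∧ ¬ b.Holds s' ∧ ∃ N', I N' s' := by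
  induction N using Nat.strong_induction_on generalizing s with
  | _ N ih =>
    by_cases hb : b.Holds s
    · obtain ⟨t, s', hr, ht, N', hN', hI⟩ := hstep N s h hb
      obtain ⟨t', s'', hr', ht', hq⟩ := ih N' hN' hI
      refine ⟨_, _, .while_true hb hr hr', ?_, hq⟩
      have := Nat.mul_le_mul_right (T + 1) (Nat.succ_le_of_lt hN')
      rw [Nat.succ_mul] at this
      omega
    · exact ⟨_, _, .while_false hb, by omega, hb, N, h⟩

/-- The integer variable kept in entry `0` of the array `a`. -/
def NExp.var (a : ℕ) : NExp := .read a (.const 0)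

/-- Run `c` with the variable `x` going through `0, 1, …` below `e`. -/
def Program.forTo (x : ℕ) (e : NExp) (c : Program) : Program :=
  .seq (.setNat x (.const 0) (.const 0))
    (.while (.ltNat (.var x) e) (.seq c (.setNat x (.const 0) (.add (.var x) (.const 1)))))

theorem wp_forTo {x : ℕ} {e : NExp} {c : Program} {s : State} {Q : ℕ → State → Prop}
    (I : ℕ → State → Prop) (N T : ℕ) (h0 : I 0 (s.setNat x 0 0))
    (hx : ∀ k s, I k s → s.nat x 0 = k ∧ e.eval s = N)
    (hstep : ∀ k < N, ∀ s, I k s →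
      WP v c s fun t s' => t ≤ T ∧ s'.nat x 0 = k ∧ I (k + 1) (s'.setNat x 0 (k + 1)))
    (hQ : ∀ t s', t ≤ N * (T + 2) + 2 → I N s' → Q t s') :
    WP v (.forTo x e c) s Q := by
  refine wp_seq (wp_setNat ?_)
  refine (wp_while (fun M s => M ≤ N ∧ I (N - M) s) (T + 1) ?_ (N := N)
    (by simpa [NExp.eval] using h0)).mono ?_
  · rintro M s ⟨hM, hI⟩ hb
    obtain ⟨h₁, h₂⟩ := hx _ _ hI
    simp only [Test.Holds, NExp.eval, NExp.var, h₁, h₂] at hb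
    refine wp_seq ((hstep _ hb s hI).mono ?_)
    rintro t s' ⟨ht, hk, hI'⟩
    refine wp_setNat ⟨by omega, M - 1, by omega, by omega, ?_⟩
    rw [show N - (M - 1) = N - M + 1 by omega]
    simpa [NExp.eval, NExp.var, hk] using hI'
  · rintro t s' ⟨ht, hb, M, hM, hI⟩
    obtain ⟨h₁, h₂⟩ := hx _ _ hI
    simp only [Test.Holds, NExp.eval, NExp.var, h₁, h₂, not_lt] at hb
    refine hQ _ _ ?_ ?_
    · have : N * (T + 1 + 1) = N * (T + 2) := rfl
      omega
    · rwa [show N - M = N by omega] at hI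

/-- The value of `S` to agent `i` (and `0` if there is no such agent). -/
noncomputable def valueOf (v : Fin n → Finset (Fin m) → ℝ) (i : ℕ) (S : Finset (Fin m)) : ℝ :=
  if h : i < n then v ⟨i, h⟩ S else 0

theorem valueOf_fin (i : Fin n) (S : Finset (Fin m)) : valueOf v i S = v i S := by
  simp [valueOf]

theorem answer_eq_valueOf {s : State} {i b : ℕ} {S : Finset (Fin m)}
    (h : ∀ j : Fin m, s.nat b j ≠ 0 ↔ j ∈ S) : answer v s i b = valueOf v i S := by
  have : (Finset.univ.filter fun j : Fin m => s.nat b j ≠ 0) = S := by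
    ext j
    simp [h]
  rw [answer, valueOf, this]

end logic

/-! ## The program

Integer arrays: `0` input, `1` owners of the items, `2` marks of the locked items, `3` set to be
queried, `4` and `8` loop variables, `5` owner to be loaded, `6` current agent, `7` current item,
`9` counter. Real arrays: `0` thresholds, `1` values of the single items, `2` answers. -/

section program

variable {m n : ℕ} {v : Fin n → Finset (Fin m) → ℝ}

/-- Load the items owned by the agent in variable `5`. -/
def load : Program :=
  .forTo 4 (.read 0 (.const 1))
    (.ite (.and (.not (.ltNat (.read 1 (.var 4)) (.var 5)))
        (.not (.ltNat (.var 5) (.read 1 (.var 4)))))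
      (.setNat 3 (.var 4) (.const 1)) (.setNat 3 (.var 4) (.const 0)))

theorem wp_load {s : State} (hm : s.nat 0 1 = m) {Q : ℕ → State → Prop}
    (hQ : ∀ t s', t ≤ m * 4 + 2 → s'.real = s.real →
      (∀ a, a ≠ 3 → a ≠ 4 → s'.nat a = s.nat a) →
      (∀ k < m, s'.nat 3 k ≠ 0 ↔ s.nat 1 k = s.nat 5 0) → Q t s') :
    WP v load s Q := by
  refine wp_forTo (fun k s' => s'.nat 4 0 = k ∧ s'.real = s.real ∧
    (∀ a, a ≠ 3 → a ≠ 4 → s'.nat a = s.nat a) ∧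
    (∀ l < k, s'.nat 3 l ≠ 0 ↔ s.nat 1 l = s.nat 5 0)) m 2 ?_ ?_ ?_ ?_
  · refine ⟨by simp [State.setNat], rfl, fun a _ ha => by simp [State.setNat, ha], ?_⟩
    intro l hl
    omega
  · rintro k s' ⟨h₁, -, h₂, -⟩
    exact ⟨h₁, by simp [NExp.eval, h₂, hm]⟩
  · rintro k hk s' ⟨h₁, h₂, h₃, h₄⟩
    have e₁ : s'.nat 1 = s.nat 1 := h₃ 1 (by decide) (by decide)
    have e₅ : s'.nat 5 = s.nat 5 := h₃ 5 (by decide) (by decide)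
    have key : ∀ x : ℕ, (x ≠ 0 ↔ s.nat 1 k = s.nat 5 0) →
        ((s'.setNat 3 k x).nat 4 0 = k ∧
        (((s'.setNat 3 k x).setNat 4 0 (k + 1)).nat 4 0 = k + 1 ∧
        ((s'.setNat 3 k x).setNat 4 0 (k + 1)).real = s.real ∧
        (∀ a, a ≠ 3 → a ≠ 4 → ((s'.setNat 3 k x).setNat 4 0 (k + 1)).nat a = s.nat a) ∧
        (∀ l < k + 1, ((s'.setNat 3 k x).setNat 4 0 (k + 1)).nat 3 l ≠ 0
          ↔ s.nat 1 l = s.nat 5 0))) := by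
      intro x hx
      refine ⟨by simp [State.setNat, h₁], by simp [State.setNat], h₂,
        fun a ha ha' => by simp [State.setNat, ha, ha', h₃], fun l hl => ?_⟩
      by_cases hlk : l = k
      · subst hlk
        simpa [State.setNat] using hx
      · simpa [State.setNat, hlk] using h₄ l (by omega)
    refine wp_ite (fun hb => wp_setNat ⟨by norm_num, ?_⟩) (fun hb => wp_setNat ⟨by norm_num, ?_⟩) <;>
      simp only [Test.Holds, NExp.eval, NExp.var, h₁, e₁, e₅, not_lt] at hb ⊢ <;>
      refine key _ ?_ <;> omega
  · rintro t s' ht ⟨-, h₂, h₃, h₄⟩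
    exact hQ t s' ht h₂ h₃ h₄

/-- Ask agent `ag` for the value of the bundle of `own`, and for its value when the mark of the
current item is replaced by `e`. -/
def probe (own ag : NExp) (r e r' : ℕ) : Program :=
  .seq (.setNat 5 (.const 0) own) <| .seq load <| .seq (.query 2 (.const r) ag 3) <|
    .seq (.setNat 3 (.var 7) (.const e)) (.query 2 (.const r') ag 3)

/-- `s'` differs from `s` only in scratch memory. -/
structure Frame (s s' : State) : Prop where
  nat : ∀ a, a ≠ 3 → a ≠ 4 → a ≠ 5 → s'.nat a = s.nat a
  real : s'.real 0 = s.real 0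

/-- One pattern serves three purposes: `e = 1` inserts the current item, `e = 0` erases it, and an
`own` that owns nothing turns the second answer into the value of a single item. -/
theorem wp_probe {s : State} (hm : s.nat 0 1 = m) {own ag : NExp} {r e r' : ℕ} (hr : r ≠ r')
    (hag : ∀ s', Frame s s' → ag.eval s' = ag.eval s) {Q : ℕ → State → Prop}
    (hQ : ∀ t s', t ≤ m * 4 + 6 → Frame s s' →
      (∀ k, k ≠ r → k ≠ r' → s'.real 2 k = s.real 2 k) →
      s'.real 2 r = valueOf v (ag.eval s)
        (Finset.univ.filter fun j : Fin m => s.nat 1 j = own.eval s) →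
      s'.real 2 r' = valueOf v (ag.eval s) (Finset.univ.filter fun j : Fin m =>
        if (j : ℕ) = s.nat 7 0 then e ≠ 0 else s.nat 1 j = own.eval s) → Q t s') :
    WP v (probe own ag r e r') s Q := by
  refine wp_seq (wp_setNat (wp_seq (wp_load (by simpa [State.setNat, NExp.eval] using hm) ?_)))
  intro t s₁ ht hreal hnat hset
  simp only [State.setNat, NExp.eval] at hreal hnat hset
  have hf : Frame s s₁ :=
    ⟨fun a h₃ h₄ h₅ => by simp [hnat a h₃ h₄, h₅], by rw [hreal]⟩
  have h7 : s₁.nat 7 = s.nat 7 := hf.nat 7 (by decide) (by decide) (by decide)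
  refine wp_seq (wp_query (wp_seq (wp_setNat (wp_query ?_))))
  have a₁ : answer v s₁ (ag.eval s₁) 3 = valueOf v (ag.eval s)
      (Finset.univ.filter fun j : Fin m => s.nat 1 j = own.eval s) := by
    rw [hag _ hf]
    refine answer_eq_valueOf fun j => ?_
    simpa using hset j j.2
  rw [a₁]
  set x := valueOf v (ag.eval s) (Finset.univ.filter fun j : Fin m => s.nat 1 j = own.eval s)
  simp only [NExp.eval, NExp.var]
  set s₂ := (s₁.setReal 2 r x).setNat 3 ((s₁.setReal 2 r x).nat 7 0) e with hs₂
  have hf₂ : Frame s s₂ := by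
    refine ⟨fun a h₃ h₄ h₅ => ?_, ?_⟩
    · simp [hs₂, State.setNat, State.setReal, h₃, hf.nat a h₃ h₄ h₅]
    · simp [hs₂, State.setNat, State.setReal, hf.real]
  have a₂ : answer v s₂ (ag.eval s₂) 3 = valueOf v (ag.eval s)
      (Finset.univ.filter fun j : Fin m =>
        if (j : ℕ) = s.nat 7 0 then e ≠ 0 else s.nat 1 j = own.eval s) := by
    rw [hag _ hf₂]
    refine answer_eq_valueOf fun j => ?_
    have := hset j j.2
    by_cases hj : (j : ℕ) = s.nat 7 0
    · simp [hs₂, State.setNat, State.setReal, h7, hj]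
    · simpa [hs₂, State.setNat, State.setReal, h7, hj] using this
  rw [a₂]
  refine hQ _ _ (by omega) ⟨fun a h₃ h₄ h₅ => ?_, ?_⟩ ?_ ?_ ?_
  · exact hf₂.nat a h₃ h₄ h₅
  · simpa [State.setReal] using hf₂.real
  · intro k hk hk'
    simp [State.setReal, hs₂, State.setNat, hk, hk', hreal]
  · simp [State.setReal, hs₂, State.setNat, hr]
  · simp [State.setReal]

/-- The threshold of the owner of the current item. -/
def ownerThreshold : RExp := .read 0 (.read 1 (.var 7))

/-- Truncate the answer `k` at two thirds of the threshold of the owner of the current item. -/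
def truncate (k : ℕ) : Program :=
  .ite (.ltReal (.mul (.cast (.const 2)) ownerThreshold)
      (.mul (.cast (.const 3)) (.read 2 (.const k))))
    (.setReal 2 (.const k) (.div (.mul (.cast (.const 2)) ownerThreshold) (.cast (.const 3)))) .skip

theorem wp_truncate {s : State} {k : ℕ} {Q : ℕ → State → Prop}
    (hQ : ∀ s', Frame s s' → (∀ l ≠ k, s'.real 2 l = s.real 2 l) →
      s'.real 2 k = min (s.real 2 k) (2 * s.real 0 (s.nat 1 (s.nat 7 0)) / 3) → Q 2 s') :
    WP v (truncate k) s Q := by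
  refine wp_ite (fun hb => wp_setReal ?_) (fun hb => wp_skip ?_) <;>
    simp only [Test.Holds, RExp.eval, NExp.eval, NExp.var, ownerThreshold, Nat.cast_ofNat,
      not_lt] at hb ⊢
  · refine hQ _ ⟨fun a _ _ _ => rfl, by simp [State.setReal]⟩
      (fun l hl => by simp [State.setReal, hl]) ?_
    rw [min_eq_right (by linarith)]
    simp [State.setReal]
  · refine hQ _ ⟨fun a _ _ _ => rfl, rfl⟩ (fun l hl => rfl) ?_
    rw [min_eq_left (by linarith)]

theorem Frame.trans {s s' s'' : State} (h : Frame s s') (h' : Frame s' s'') : Frame s s'' :=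
  ⟨fun a h₃ h₄ h₅ => (h'.nat a h₃ h₄ h₅).trans (h.nat a h₃ h₄ h₅), h'.real.trans h.real⟩

/-- The memory `s` holds the owners `A`, the thresholds `τ` and the locked items `L`. -/
structure Rep (s : State) (A : Fin m → Fin n) (τ : Fin n → ℝ) (L : Finset (Fin m)) : Prop where
  agents : s.nat 0 0 = n
  items : s.nat 0 1 = m
  owner : ∀ j : Fin m, s.nat 1 j = A j
  locked : ∀ j : Fin m, s.nat 2 j = if j ∈ L then 1 else 0
  threshold : ∀ i : Fin n, s.real 0 i = τ i

theorem Rep.of_frame {s s' : State} {A : Fin m → Fin n} {τ : Fin n → ℝ} {L : Finset (Fin m)}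
    (h : Rep s A τ L) (hf : Frame s s') : Rep s' A τ L where
  agents := by rw [hf.nat 0 (by decide) (by decide) (by decide), h.agents]
  items := by rw [hf.nat 0 (by decide) (by decide) (by decide), h.items]
  owner j := by rw [hf.nat 1 (by decide) (by decide) (by decide), h.owner]
  locked j := by rw [hf.nat 2 (by decide) (by decide) (by decide), h.locked]
  threshold i := by rw [hf.real, h.threshold]

/-- Compute the values needed to treat the current agent and the current item. -/
def evaluate : Program :=
  .seq (probe (.var 6) (.var 6) 0 1 1) <|
    .seq (probe (.read 1 (.var 7)) (.read 1 (.var 7)) 2 0 3) <|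
      .seq (probe (.read 0 (.const 0)) (.var 6) 5 1 4) <| .seq (truncate 2) (truncate 3)

/-- The item counter may equal `m`, past the last item; then only the value of the bundle is
asserted and the other answers are junk. -/
theorem wp_evaluate {s : State} {A : Fin m → Fin n} {τ : Fin n → ℝ} {L : Finset (Fin m)}
    (h : Rep s A τ L) {i : Fin n} (hi : s.nat 6 0 = i) {Q : ℕ → State → Prop}
    (hQ : ∀ t s', t ≤ 12 * m + 22 → Frame s s' → s'.real 2 0 = v i (bundle A i) →
      (∀ g : Fin m, s.nat 7 0 = g → s'.real 2 1 = v i (insert g (bundle A i)) ∧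
        s'.real 2 2 = min (v (A g) (bundle A (A g))) (2 * τ (A g) / 3) ∧
        s'.real 2 3 = min (v (A g) ((bundle A (A g)).erase g)) (2 * τ (A g) / 3) ∧
        s'.real 2 4 = v i {g}) → Q t s') :
    WP v evaluate s Q := by
  have hvar : ∀ (s : State) (a : ℕ), a ≠ 3 → a ≠ 4 → a ≠ 5 → ∀ s', Frame s s' →
      (NExp.var a).eval s' = (NExp.var a).eval s := by
    intro s a h₃ h₄ h₅ s' hf
    simp [NExp.eval, NExp.var, hf.nat a h₃ h₄ h₅]
  refine wp_seq (wp_probe h.items (by decide) (hvar _ _ (by decide) (by decide) (by decide)) ?_)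
  intro t₁ s₁ ht₁ f₁ k₁ x₀ x₁
  have r₁ := h.of_frame f₁
  refine wp_seq (wp_probe r₁.items (by decide) ?_ ?_)
  · intro s' hf
    simp [NExp.eval, NExp.var, hf.nat]
  intro t₂ s₂ ht₂ f₂ k₂ x₂ x₃
  have r₂ := r₁.of_frame f₂
  -- Owner `n` does not exist, so the loaded set is empty and slot 5 is a dummy.
  refine wp_seq (wp_probe r₂.items (by decide)
    (hvar _ _ (by decide) (by decide) (by decide)) ?_)
  intro t₃ s₃ ht₃ f₃ k₃ _ x₄
  have r₃ := r₂.of_frame f₃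
  refine wp_seq (wp_truncate fun s₄ f₄ k₄ y₂ => wp_truncate fun s₅ f₅ k₅ y₃ => ?_)
  have g₂ := f₁.trans f₂
  have g₃ := g₂.trans f₃
  have g₄ := g₃.trans f₄
  have r₄ := r₃.of_frame f₄
  refine hQ _ _ (by omega) (g₄.trans f₅) ?_ ?_
  · rw [k₅ _ (by decide), k₄ _ (by decide), k₃ _ (by decide) (by decide),
      k₂ _ (by decide) (by decide), x₀]
    simp only [NExp.eval, NExp.var, hi, valueOf_fin, h.owner]
    congr 1
    ext j
    simp [bundle, Fin.ext_iff]
  · intro g hg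
    have hg₃ : s₃.nat 7 0 = g := by rw [g₃.nat _ (by decide) (by decide) (by decide), hg]
    have hg₄ : s₄.nat 7 0 = g := by rw [g₄.nat _ (by decide) (by decide) (by decide), hg]
    have hg₁ : s₁.nat 7 0 = g := by rw [f₁.nat _ (by decide) (by decide) (by decide), hg]
    have hg₂ : s₂.nat 7 0 = g := by rw [g₂.nat _ (by decide) (by decide) (by decide), hg]
    have hi₂ : s₂.nat 6 0 = i := by rw [g₂.nat _ (by decide) (by decide) (by decide), hi]
    refine ⟨?_, ?_, ?_, ?_⟩
    · rw [k₅ _ (by decide), k₄ _ (by decide), k₃ _ (by decide) (by decide),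
        k₂ _ (by decide) (by decide), x₁]
      simp only [NExp.eval, NExp.var, hi, valueOf_fin, h.owner, hg]
      congr 1
      ext j
      by_cases hj : j = g <;> simp [bundle, Fin.ext_iff, hj]
      simp [Fin.ext_iff] at hj
      simp [hj]
    · rw [k₅ _ (by decide), y₂, k₃ _ (by decide) (by decide), x₂]
      simp only [NExp.eval, NExp.var, hg₁, hg₃, r₁.owner, r₃.owner, r₃.threshold, valueOf_fin]
      congr 2
      ext j
      simp [bundle, Fin.ext_iff]
    · rw [y₃, k₄ _ (by decide), k₃ _ (by decide) (by decide), x₃]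
      simp only [NExp.eval, NExp.var, hg₁, hg₄, r₁.owner, r₄.owner, r₄.threshold, valueOf_fin]
      congr 2
      ext j
      by_cases hj : j = g <;> simp [bundle, Fin.ext_iff, hj]
      simp [Fin.ext_iff] at hj
      simp [hj]
    · rw [k₅ _ (by decide), k₄ _ (by decide), x₄]
      simp only [NExp.eval, NExp.var, hi₂, hg₂, r₂.owner, r₂.agents, valueOf_fin]
      congr 1
      ext j
      have := (A j).2
      by_cases hj : j = g
      · simp [hj]
      · have hj' : (j : ℕ) ≠ g := fun e => hj (Fin.ext e)
        simp [hj, hj', this.ne]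

/-! ### The main loop -/

/-- Start again with the first agent and the first item. -/
def restart : Program :=
  .seq (.setNat 6 (.const 0) (.const 0)) (.setNat 7 (.const 0) (.const 0))

/-- The threshold of the current agent. -/
def threshold : RExp := .read 0 (.var 6)

/-- `k` times `x`. -/
def RExp.times (k : ℕ) (x : RExp) : RExp := .mul (.cast (.const k)) x

/-- The answer `k`. -/
def ans (k : ℕ) : RExp := .read 2 (.const k)

/-- The current item is not locked. -/
def unlocked : Test := .not (.ltNat (.const 0) (.read 2 (.var 7)))

/-- The current item belongs to the current agent. -/
def owned : Test :=
  .and (.not (.ltNat (.read 1 (.var 7)) (.var 6))) (.not (.ltNat (.var 6) (.read 1 (.var 7))))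

/-- Moving the current item to the current agent improves the potential too little. -/
def unprofitable : Test :=
  .ltReal (.sub (.sub (.div (ans 1) threshold) (.div (ans 0) threshold))
      (.sub (.div (ans 2) ownerThreshold) (.div (ans 3) ownerThreshold)))
    (.div (.cast (.const 2))
      (.mul (.cast (.const 3)) (.add (.cast (.read 0 (.const 1))) (.cast (.const 1)))))

/-- Lower the threshold of the current agent. -/
def lowerStep : Program :=
  .seq (.setReal 0 (.var 6) (.mul (.div (.cast (.const 19)) (.cast (.const 20))) threshold)) restart

/-- Lock the current item with the current agent. -/
def lockStep : Program :=
  .seq (.setNat 1 (.var 7) (.var 6)) <| .seq (.setNat 2 (.var 7) (.const 1)) <|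
    .seq (.setReal 0 (.var 6) (.cast (.const 0))) restart

/-- Move the current item to the current agent. -/
def moveStep : Program := .seq (.setNat 1 (.var 7) (.var 6)) restart

/-- Treat the current agent and the current item. -/
def choose : Program :=
  .ite (.not (.ltReal (.times 3 (ans 0)) threshold))
    (.seq (.setNat 6 (.const 0) (.add (.var 6) (.const 1))) (.setNat 7 (.const 0) (.const 0))) <|
  .ite (.not (.ltNat (.var 7) (.read 0 (.const 1)))) lowerStep <|
  .ite (.and unlocked (.not (.ltReal (.times 3 (ans 4)) threshold))) lockStep <|
  .ite (.and unlocked (.and (.not owned) (.not unprofitable))) moveStep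
    (.setNat 7 (.const 0) (.add (.var 7) (.const 1)))

/-- The invariant of the main loop, with a bound `N` on the number of further iterations. -/
def LoopInv (v : Fin n → Finset (Fin m) → ℝ) (τ₀ : Fin n → ℝ) (N : ℕ) (s : State) : Prop :=
  ∃ (A : Fin m → Fin n) (τ : Fin n → ℝ) (L : Finset (Fin m)) (q : ℕ),
    Rep s A τ L ∧ Inv v τ₀ A τ L ∧ s.nat 6 0 ≤ n ∧ s.nat 7 0 ≤ m ∧
    4 * (n : ℝ) ≤ potential v τ₀ A τ L + q * (1 / (20 * (m + 1))) ∧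
    (∀ j : Fin n, (j : ℕ) < s.nat 6 0 → τ j ≤ 3 * v j (bundle A j)) ∧
    (∀ (i : Fin n) (g : Fin m), s.nat 6 0 = i → (g : ℕ) < s.nat 7 0 → g ∉ L → A g ≠ i →
      profit v A τ i g < 2 / (3 * (m + 1))) ∧
    N = q * ((n + 1) * (m + 2)) + (n - s.nat 6 0) * (m + 2) + (m - s.nat 7 0)

/-- An improvement spends one unit of the budget `q`, which cannot be 0 since the potential stays
below `4n`. One unit is worth `(n + 1)(m + 2)` in the rank, more than the `n(m + 2) + m` of a
complete new scan. -/
theorem LoopInv.restart {τ₀ : Fin n → ℝ} {A A' : Fin m → Fin n} {τ τ' : Fin n → ℝ}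
    {L L' : Finset (Fin m)} {q i g : ℕ} {s : State} (hn : 0 < n) (h : Rep s A' τ' L')
    (hinv : Inv v τ₀ A' τ' L') (h6 : s.nat 6 0 = 0) (h7 : s.nat 7 0 = 0)
    (hq : 4 * (n : ℝ) ≤ potential v τ₀ A τ L + q * (1 / (20 * (m + 1))))
    (hp : potential v τ₀ A τ L + 1 / (20 * (m + 1)) ≤ potential v τ₀ A' τ' L') :
    ∃ N' < q * ((n + 1) * (m + 2)) + (n - i) * (m + 2) + (m - g), LoopInv v τ₀ N' s := by
  have hlt := hinv.potential_lt hn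
  obtain ⟨q, rfl⟩ : ∃ q', q = q' + 1 := by
    refine Nat.exists_eq_succ_of_ne_zero fun h0 => ?_
    rw [h0, Nat.cast_zero, zero_mul] at hq
    have : (0 : ℝ) < 1 / (20 * (m + 1)) := by positivity
    linarith
  refine ⟨_, ?_, A', τ', L', q, h, hinv, by omega, by omega, ?_, ?_, ?_, rfl⟩
  · rw [h6, h7]
    have : (q + 1) * ((n + 1) * (m + 2)) = q * ((n + 1) * (m + 2)) + n * (m + 2) + (m + 2) := by
      ring
    rw [this, Nat.sub_zero, Nat.sub_zero]
    omega
  · push_cast at hq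
    linarith
  · intro j hj
    omega
  · intro i g _ hg
    omega

theorem wp_restart {s : State} {Q : ℕ → State → Prop}
    (h : Q 2 ((s.setNat 6 0 0).setNat 7 0 0)) : WP v restart s Q :=
  wp_seq (wp_setNat (wp_setNat h))

theorem wp_body {τ₀ : Fin n → ℝ} (hn : 0 < n) (hv : ∀ i, IsValuation (v i))
    (hs : ∀ j, IsStart n (v j) (τ₀ j)) {N : ℕ} {s : State} (h : LoopInv v τ₀ N s)
    (hlt : s.nat 6 0 < n) :
    WP v (.seq evaluate choose) s fun t s' =>
      t ≤ 12 * m + 31 ∧ ∃ N' < N, LoopInv v τ₀ N' s' := by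
  obtain ⟨A, τ, L, q, hrep, hinv, -, h7, hq, hsat, hsearch, rfl⟩ := h
  obtain ⟨i, hi⟩ : ∃ i : Fin n, s.nat 6 0 = i := ⟨⟨_, hlt⟩, rfl⟩
  obtain ⟨g, hg⟩ : ∃ g, s.nat 7 0 = g := ⟨_, rfl⟩
  rw [hi, hg] at hsearch ⊢
  rw [hi] at hsat hlt
  rw [hg] at h7
  refine wp_seq (wp_evaluate hrep hi ?_)
  intro t s' ht hf x₀ hx
  have hrep' := hrep.of_frame hf
  have hi' : s'.nat 6 0 = i := by rw [hf.nat _ (by decide) (by decide) (by decide), hi]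
  have hg' : s'.nat 7 0 = g := by rw [hf.nat _ (by decide) (by decide) (by decide), hg]
  clear hf hrep hi
  have hthr : threshold.eval s' = τ i := by
    simp [threshold, RExp.eval, NExp.eval, NExp.var, hi', hrep'.threshold]
  have hx₀ : (ans 0).eval s' = v i (bundle A i) := by simp [ans, RExp.eval, NExp.eval, x₀]
  refine wp_ite (fun hb => ?_) fun hb => wp_ite (fun hb₂ => ?_) fun hb₂ => ?_
  · simp only [Test.Holds, RExp.times, RExp.eval, NExp.eval, hthr, hx₀, Nat.cast_ofNat,
      not_lt] at hb
    refine wp_seq (wp_setNat (wp_setNat ⟨by omega, _, ?_, A, τ, L, q, ⟨?_, ?_, ?_, ?_, ?_⟩,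
      hinv, ?_, ?_, hq, ?_, ?_, rfl⟩))
    all_goals simp only [State.setNat, NExp.eval, NExp.var]
    · simp only [hi', Function.update_self, ne_eq, Nat.reduceEqDiff,
        not_false_eq_true, Function.update_of_ne, Nat.sub_zero]
      -- The next agent lowers the rank by `m + 2`, while resetting the item counter adds at most
      -- `m`.
      obtain ⟨d, hd⟩ : ∃ d, n - (i : ℕ) = d + 1 := ⟨n - i - 1, by omega⟩
      rw [show n - ((i : ℕ) + 1) = d by omega, hd, Nat.add_mul d]
      omega
    · simp [hrep'.agents]
    · simp [hrep'.items]
    · simp [hrep'.owner]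
    · simp [hrep'.locked]
    · simp [hrep'.threshold]
    · simp [hi']
    · simp
    · intro j hj
      simp only [hi', Function.update_self, ne_eq, Nat.reduceEqDiff,
        not_false_eq_true, Function.update_of_ne] at hj
      rcases Nat.lt_succ_iff_lt_or_eq.1 hj with hj | hj
      · exact hsat j hj
      · rw [Fin.ext hj]
        exact hb
    · intro j g' _ hg'
      simp at hg'
  all_goals
    simp only [Test.Holds, RExp.times, RExp.eval, NExp.eval, NExp.var, hthr, hx₀, Nat.cast_ofNat,
      not_not, hg', hrep'.items] at hb hb₂
  all_goals have hτi : 0 < τ i := (mul_nonneg (by norm_num) ((hv i).nonneg _)).trans_lt hb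
  · have hmms : mms n (v i) < τ i := by
      -- The item counter has reached `m`, so the scan has rejected every candidate item.
      refine mms_lt_of_stuck hv hinv.nonneg hinv.card hb fun g' hg' hA => ?_
      exact hsearch i g' rfl (by omega) hg' hA
    refine wp_seq (wp_setReal (wp_restart ⟨by omega, ?_⟩))
    refine LoopInv.restart hn (A' := A) (τ' := Function.update τ i (19 / 20 * τ i)) (L' := L)
      ⟨?_, ?_, ?_, ?_, ?_⟩ (hinv.lower hmms hτi) ?_ ?_ hq
      (hinv.potential_lower hv hmms hτi ((hs i).le_mul_mms hn (hv i)))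
    · simp [State.setNat, State.setReal, hrep'.agents]
    · simp [State.setNat, State.setReal, hrep'.items]
    · simp [State.setNat, State.setReal, hrep'.owner]
    · simp [State.setNat, State.setReal, hrep'.locked]
    · intro j
      simp only [State.setNat, State.setReal, RExp.eval, hthr, NExp.eval, NExp.var, hi',
        Function.update_self, Nat.cast_ofNat]
      simp only [Function.update_apply, Fin.ext_iff, hrep'.threshold]
    · simp [State.setNat]
    · simp [State.setNat]
  obtain ⟨g, rfl⟩ : ∃ g' : Fin m, g = g' := ⟨⟨g, hb₂⟩, rfl⟩
  obtain ⟨x₁, x₂, x₃, x₄⟩ := hx g hg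
  clear hx
  have hunl : unlocked.Holds s' ↔ g ∉ L := by
    simp only [unlocked, Test.Holds, NExp.eval, NExp.var, hg', hrep'.locked]
    split_ifs with hL <;> simp [hL]
  refine wp_ite (fun hb₃ => ?_) fun hb₃ => wp_ite (fun hb₄ => ?_) fun hb₄ => ?_
  · simp only [Test.Holds, hunl, RExp.times, RExp.eval, NExp.eval, ans, hthr, x₄, Nat.cast_ofNat,
      not_lt] at hb₃
    refine wp_seq (wp_setNat (wp_seq (wp_setNat (wp_seq (wp_setReal
      (wp_restart ⟨by omega, ?_⟩))))))
    have hpot := hinv.potential_lock hv (i := i) hb₃.1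
    refine LoopInv.restart hn (A' := Function.update A g i) (τ' := Function.update τ i 0)
      (L' := insert g L) ⟨?_, ?_, ?_, ?_, ?_⟩ (hinv.lock hb₃.1 hτi hb₃.2) ?_ ?_ hq
      (le_trans ?_ hpot)
    · simp [State.setNat, State.setReal, hrep'.agents]
    · simp [State.setNat, State.setReal, hrep'.items]
    · intro j
      simp only [State.setNat, State.setReal, NExp.eval, NExp.var, hi', hg']
      by_cases hj : j = g
      · simp [hj]
      · have hj' : (j : ℕ) ≠ g := fun e => hj (Fin.ext e)
        simp [hj, hj', hrep'.owner]
    · intro j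
      simp only [State.setNat, State.setReal, NExp.eval, NExp.var, hi', hg']
      by_cases hj : j = g
      · simp [hj, hg']
      · have hj' : (j : ℕ) ≠ g := fun e => hj (Fin.ext e)
        simp [hj, hj', hrep'.locked, hg']
    · intro j
      simp only [State.setNat, State.setReal, RExp.eval, NExp.eval, NExp.var]
      by_cases hj : j = i
      · simp [hj, hi']
      · have hj' : (j : ℕ) ≠ i := fun e => hj (Fin.ext e)
        simp [hj, hj', hrep'.threshold, hi']
    · simp [State.setNat]
    · simp [State.setNat]
    · have : (1 : ℝ) / (20 * (m + 1)) ≤ 1 / 20 := by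
        apply one_div_le_one_div_of_le <;> linarith [(Nat.cast_nonneg m : (0 : ℝ) ≤ m)]
      linarith
  all_goals
    have hown : owned.Holds s' ↔ A g = i := by
      simp only [owned, Test.Holds, NExp.eval, NExp.var, hg', hi', hrep'.owner, Fin.ext_iff]
      omega
    have hprofit : unprofitable.Holds s' ↔ profit v A τ i g < 2 / (3 * (m + 1)) := by
      simp only [unprofitable, Test.Holds, RExp.eval, hthr, NExp.eval, ans, ownerThreshold,
        NExp.var, hg', hrep'.owner, hrep'.threshold, hrep'.items, x₀, x₁, x₂, x₃, profit, capped,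
        Nat.cast_ofNat, Nat.cast_one]
    simp only [Test.Holds, hunl, RExp.times, RExp.eval, NExp.eval, ans, hthr, x₄, Nat.cast_ofNat,
      hown, hprofit, not_and, not_not] at hb₃ hb₄
  · obtain ⟨hL, hA, hpr⟩ := hb₄
    refine wp_seq (wp_setNat (wp_restart ⟨by omega, ?_⟩))
    -- The failed lock test `hb₃` supplies the smallness of the item.
    have hpot := potential_move (τ₀ := τ₀) (L := L) hv hb (hb₃ hL) hA
    refine LoopInv.restart hn (A' := Function.update A g i) (τ' := τ)
      (L' := L) ⟨?_, ?_, ?_, ?_, ?_⟩ (hinv.move hL) ?_ ?_ hq (hpot ▸ ?_)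
    · simp [State.setNat, hrep'.agents]
    · simp [State.setNat, hrep'.items]
    · intro j
      simp only [State.setNat, NExp.eval, NExp.var, hi', hg']
      by_cases hj : j = g
      · simp [hj]
      · have hj' : (j : ℕ) ≠ g := fun e => hj (Fin.ext e)
        simp [hj, hj', hrep'.owner]
    · simp [State.setNat, hrep'.locked]
    · simp [State.setNat, hrep'.threshold]
    · simp [State.setNat]
    · simp [State.setNat]
    · have : (1 : ℝ) / (20 * (m + 1)) ≤ 2 / (3 * (m + 1)) := by
        rw [div_le_div_iff₀ (by positivity) (by positivity)]
        linarith [(Nat.cast_nonneg m : (0 : ℝ) ≤ m)]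
      linarith
  · refine wp_setNat ⟨by omega, _, ?_, A, τ, L, q, ⟨?_, ?_, ?_, ?_, ?_⟩,
      hinv, ?_, ?_, hq, ?_, ?_, rfl⟩
    all_goals simp only [State.setNat, NExp.eval, NExp.var]
    · simp [hi', hg']
      omega
    · simp [hrep'.agents]
    · simp [hrep'.items]
    · simp [hrep'.owner]
    · simp [hrep'.locked]
    · simp [hrep'.threshold]
    · simp [hi']
    · simp [hg']
    · simpa [hi'] using hsat
    · intro j g' hj hlt' hL hA
      simp only [hi', hg', Function.update_self, ne_eq, Nat.reduceEqDiff,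
        not_false_eq_true, Function.update_of_ne] at hj hlt'
      obtain rfl : i = j := Fin.ext hj
      rcases Nat.lt_succ_iff_lt_or_eq.1 hlt' with h' | h'
      · exact hsearch i g' rfl h' hL hA
      · obtain rfl : g' = g := Fin.ext h'
        exact hb₄ hL hA

/-! ### The initial thresholds -/

/-- Ask the current agent for the value of the current item. -/
def askSingle : Program :=
  .seq (.setNat 3 (.var 7) (.const 1)) <|
    .seq (.query 1 (.var 7) (.var 6) 3) (.setNat 3 (.var 7) (.const 0))

/-- Ask the current agent for the values of all items. -/
def askSingles : Program := .forTo 7 (.read 0 (.const 1)) askSingle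

/-- Each round marks one item and unmarks it again, so the query array must be zero at the start and
is zero at the end. -/
theorem wp_askSingles {s : State} (hm : s.nat 0 1 = m) {i : Fin n} (hi : s.nat 6 0 = i)
    (h3 : ∀ k, s.nat 3 k = 0) {Q : ℕ → State → Prop}
    (hQ : ∀ t s', t ≤ m * 5 + 2 → (∀ a, a ≠ 7 → s'.nat a = s.nat a) →
      s'.real 0 = s.real 0 → (∀ g : Fin m, s'.real 1 g = v i {g}) → Q t s') :
    WP v askSingles s Q := by
  refine wp_forTo (fun k s' => s'.nat 7 0 = k ∧ (∀ a, a ≠ 7 → s'.nat a = s.nat a) ∧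
    s'.real 0 = s.real 0 ∧ ∀ g : Fin m, (g : ℕ) < k → s'.real 1 g = v i {g}) m 3 ?_ ?_ ?_ ?_
  · refine ⟨by simp [State.setNat], fun a ha => by simp [State.setNat, ha], rfl, ?_⟩
    intro g hg
    omega
  · rintro k s' ⟨h₁, h₂, -, -⟩
    exact ⟨h₁, by simp [NExp.eval, h₂, hm]⟩
  · rintro k hk s' ⟨h₁, h₂, h₃, h₄⟩
    have e6 : s'.nat 6 0 = i := by rw [h₂ 6 (by decide), hi]
    have e3 : ∀ l, s'.nat 3 l = 0 := fun l => by rw [h₂ 3 (by decide), h3]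
    have a₁ : answer v (s'.setNat 3 k 1) i 3 = v i {⟨k, hk⟩} := by
      rw [answer_eq_valueOf (S := {⟨k, hk⟩}), valueOf_fin]
      intro j
      by_cases hj : (j : ℕ) = k <;> simp [State.setNat, hj, Fin.ext_iff, e3]
    refine wp_seq (wp_setNat (wp_seq (wp_query (wp_setNat ⟨by norm_num, ?_, ?_, ?_, ?_, ?_⟩))))
    all_goals simp only [NExp.eval, NExp.var, h₁]
    · simp [State.setNat, State.setReal, h₁]
    · simp [State.setNat]
    · intro a ha
      by_cases ha3 : a = 3
      · subst ha3
        funext l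
        by_cases hl : l = k <;> simp [State.setNat, State.setReal, h₁, hl, e3, h3]
      · simp [State.setNat, State.setReal, ha, ha3, h₂]
    · simp [State.setNat, State.setReal, h₃]
    · intro g hg
      have e6' : (s'.setNat 3 k 1).nat 6 0 = i := by simp [State.setNat, e6]
      have e7' : (s'.setNat 3 k 1).nat 7 0 = k := by simp [State.setNat, h₁]
      rw [e6', e7', a₁]
      by_cases hgk : (g : ℕ) = k
      · subst hgk
        simp [State.setNat, State.setReal]
      · simpa [State.setNat, State.setReal, hgk] using h₄ g (by omega)
  · rintro t s' ht ⟨-, h₂, h₃, h₄⟩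
    exact hQ t s' ht h₂ h₃ fun g => h₄ g g.2

/-- Count the items worth at least as much as the current item. -/
def count : Program :=
  .forTo 8 (.read 0 (.const 1))
    (.ite (.ltReal (.read 1 (.var 8)) (.read 1 (.var 7))) .skip
      (.setNat 9 (.const 0) (.add (.var 9) (.const 1))))

theorem wp_count {s : State} (hm : s.nat 0 1 = m) {g : Fin m} (hg : s.nat 7 0 = g)
    (h9 : s.nat 9 0 = 0) {f : Finset (Fin m) → ℝ} (hf : ∀ h : Fin m, s.real 1 h = f {h})
    {Q : ℕ → State → Prop}
    (hQ : ∀ t s', t ≤ m * 4 + 2 → (∀ a, a ≠ 8 → a ≠ 9 → s'.nat a = s.nat a) →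
      s'.real = s.real → s'.nat 9 0 = rankOf f g → Q t s') :
    WP v count s Q := by
  refine wp_forTo (fun k s' => s'.nat 8 0 = k ∧ (∀ a, a ≠ 8 → a ≠ 9 → s'.nat a = s.nat a) ∧
    s'.real = s.real ∧
    s'.nat 9 0 = (Finset.univ.filter fun h : Fin m => (h : ℕ) < k ∧ f {g} ≤ f {h}).card)
    m 2 ?_ ?_ ?_ ?_
  · refine ⟨by simp [State.setNat], fun a ha _ => by simp [State.setNat, ha], rfl, ?_⟩
    simp [State.setNat, h9]
  · rintro k s' ⟨h₁, h₂, -, -⟩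
    exact ⟨h₁, by simp [NExp.eval, h₂, hm]⟩
  · rintro k hk s' ⟨h₁, h₂, h₃, h₄⟩
    have e7 : s'.nat 7 0 = g := by rw [h₂ 7 (by decide) (by decide), hg]
    have hk' : s.real 1 k = f {⟨k, hk⟩} := hf ⟨k, hk⟩
    refine wp_ite (fun hb => wp_skip ⟨by norm_num, h₁, ?_, ?_, h₃, ?_⟩)
      (fun hb => wp_setNat ⟨by norm_num, ?_, ?_, ?_, h₃, ?_⟩)
    all_goals
      simp only [Test.Holds, RExp.eval, NExp.eval, NExp.var, h₁, h₃, e7, hf, hk'] at hb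
    · simp [State.setNat]
    · intro a ha ha'
      simp [State.setNat, ha, h₂ a ha ha']
    · simp only [State.setNat, ne_eq, Nat.reduceEqDiff, not_false_eq_true,
        Function.update_of_ne, h₄]
      congr 1
      ext h
      simp only [Finset.mem_filter, Finset.mem_univ, true_and]
      refine ⟨fun hh => ⟨by omega, hh.2⟩, fun hh => ⟨?_, hh.2⟩⟩
      rcases Nat.lt_succ_iff_lt_or_eq.1 hh.1 with h' | h'
      · exact h'
      · obtain rfl : h = ⟨k, hk⟩ := Fin.ext h'
        exact absurd hb (not_lt.2 hh.2)
    · simp [State.setNat, NExp.eval, h₁]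
    · simp [State.setNat]
    · intro a ha ha'
      simp [State.setNat, ha, ha', h₂ a ha ha', NExp.eval]
    · simp only [State.setNat, ne_eq, Nat.reduceEqDiff, not_false_eq_true,
        Function.update_of_ne, Function.update_self, NExp.eval, NExp.var, h₄]
      rw [← Finset.card_insert_of_notMem (a := (⟨k, hk⟩ : Fin m)) (by simp)]
      congr 1
      ext h
      simp only [Finset.mem_filter, Finset.mem_univ, true_and, Finset.mem_insert]
      constructor
      · rintro (rfl | hh)
        · exact ⟨Nat.lt_succ_self _, not_lt.1 hb⟩
        · exact ⟨by omega, hh.2⟩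
      · intro hh
        rcases Nat.lt_succ_iff_lt_or_eq.1 hh.1 with h' | h'
        · exact Or.inr ⟨h', hh.2⟩
        · exact Or.inl (Fin.ext h')
  · rintro t s' ht ⟨-, h₂, h₃, h₄⟩
    exact hQ t s' ht h₂ h₃ (by simp [h₄, rankOf])

/-- `m` times the value of the current item. -/
def candidate : RExp := .mul (.cast (.read 0 (.const 1))) (.read 1 (.var 7))

/-- Raise the threshold of the current agent to the candidate given by the current item, if at
least `n` items are worth as much as this item. -/
def raise : Program :=
  .seq (.setNat 9 (.const 0) (.const 0)) <| .seq count <|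
    .ite (.and (.not (.ltNat (.var 9) (.read 0 (.const 0)))) (.ltReal threshold candidate))
      (.setReal 0 (.var 6) candidate) .skip

/-- Compute the first threshold of the current agent. -/
def raiseAll : Program := .forTo 7 (.read 0 (.const 1)) raise

/-- The threshold entry itself is the running maximum over items of rank at least `n`; it stays 0 if
there are none. -/
theorem wp_raiseAll {s : State} (hn : s.nat 0 0 = n) (hm : s.nat 0 1 = m) {i : ℕ}
    (hi : s.nat 6 0 = i) (h0 : s.real 0 i = 0) {f : Finset (Fin m) → ℝ}
    (hf : ∀ h : Fin m, s.real 1 h = f {h}) {Q : ℕ → State → Prop}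
    (hQ : ∀ t s', t ≤ m * (4 * m + 7) + 2 → (∀ a, a ≠ 7 → a ≠ 8 → a ≠ 9 → s'.nat a = s.nat a) →
      (∀ j, j ≠ i → s'.real 0 j = s.real 0 j) → IsStart n f (s'.real 0 i) → Q t s') :
    WP v raiseAll s Q := by
  refine wp_forTo (fun k s' => s'.nat 7 0 = k ∧
    (∀ a, a ≠ 7 → a ≠ 8 → a ≠ 9 → s'.nat a = s.nat a) ∧ s'.real 1 = s.real 1 ∧
    (∀ j, j ≠ i → s'.real 0 j = s.real 0 j) ∧
    (s'.real 0 i = 0 ∨ ∃ g, n ≤ rankOf f g ∧ s'.real 0 i = m * f {g}) ∧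
    (∀ g : Fin m, (g : ℕ) < k → n ≤ rankOf f g → m * f {g} ≤ s'.real 0 i) ∧ 0 ≤ s'.real 0 i)
    m (4 * m + 5) ?_ ?_ ?_ ?_
  · refine ⟨by simp [State.setNat], fun a ha _ _ => by simp [State.setNat, ha], rfl,
      fun _ _ => rfl, Or.inl h0, ?_, h0.ge⟩
    intro g hg
    omega
  · rintro k s' ⟨h₁, h₂, -⟩
    exact ⟨h₁, by simp [NExp.eval, h₂, hm]⟩
  · rintro k hk s' ⟨h₁, h₂, h₃, h₄, h₅, h₆, h₇⟩
    obtain ⟨g, rfl⟩ : ∃ g : Fin m, k = g := ⟨⟨k, hk⟩, rfl⟩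
    refine wp_seq (wp_setNat (wp_seq (wp_count (g := g) (f := f)
      (by simp [State.setNat, h₂, hm]) (by simp [State.setNat, h₁])
      (by simp [State.setNat, NExp.eval]) (fun h => by simp [State.setNat, h₃, hf]) ?_)))
    intro t s₁ ht hnat hreal h9
    simp only [State.setNat] at hreal
    have hnat' : ∀ a, a ≠ 8 → a ≠ 9 → s₁.nat a = s'.nat a := fun a h8 h9 => by
      rw [hnat a h8 h9]
      simp [State.setNat, h9]
    have e7 : s₁.nat 7 0 = g := by rw [hnat' 7 (by decide) (by decide), h₁]
    have e6 : s₁.nat 6 0 = i := by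
      rw [hnat' 6 (by decide) (by decide), h₂ 6 (by decide) (by decide) (by decide), hi]
    have e0 : s₁.nat 0 = s.nat 0 := by
      rw [hnat' 0 (by decide) (by decide), h₂ 0 (by decide) (by decide) (by decide)]
    have hc : candidate.eval s₁ = m * f {g} := by
      simp [candidate, RExp.eval, NExp.eval, NExp.var, e0, e7, hm, hreal, h₃, hf]
    have ht : threshold.eval s₁ = s'.real 0 i := by
      simp [threshold, RExp.eval, NExp.eval, NExp.var, e6, hreal]
    refine wp_ite (fun hb => wp_setReal ⟨by omega, ?_, ?_, ?_, ?_, ?_, ?_, ?_, ?_⟩)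
      (fun hb => wp_skip ⟨by omega, e7, ?_, ?_, ?_, ?_, ?_, ?_, ?_⟩)
    all_goals
      simp only [Test.Holds, NExp.eval, NExp.var, h9, e0, hn, hc, ht, not_lt, not_and] at hb
    · simp [State.setReal, e7]
    · simp [State.setNat]
    · intro a ha7 ha8 ha9
      simp [State.setNat, State.setReal, ha7, hnat' a ha8 ha9, h₂ a ha7 ha8 ha9]
    · simp [State.setNat, State.setReal, hreal, h₃]
    · intro j hj
      simp [State.setNat, State.setReal, NExp.eval, NExp.var, e6, hj, hreal, h₄ j hj]
    · refine Or.inr ⟨g, hb.1, ?_⟩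
      simp [State.setNat, State.setReal, NExp.eval, NExp.var, e6, hc]
    · intro h hh hr
      simp only [State.setNat, State.setReal, NExp.eval, NExp.var, e6, hc, Function.update_self]
      rcases Nat.lt_succ_iff_lt_or_eq.1 hh with h' | h'
      · exact (h₆ h h' hr).trans hb.2.le
      · rw [Fin.ext h']
    · simp only [State.setNat, State.setReal, NExp.eval, NExp.var, e6, hc, Function.update_self]
      exact h₇.trans hb.2.le
    · simp [State.setNat]
    · intro a ha7 ha8 ha9
      simp [State.setNat, ha7, hnat' a ha8 ha9, h₂ a ha7 ha8 ha9]
    · simp [State.setNat, hreal, h₃]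
    · intro j hj
      simp [State.setNat, hreal, h₄ j hj]
    · simpa [State.setNat, hreal] using h₅
    · intro h hh hr
      simp only [State.setNat, hreal]
      rcases Nat.lt_succ_iff_lt_or_eq.1 hh with h' | h'
      · exact h₆ h h' hr
      · rw [Fin.ext h'] at hr ⊢
        exact hb hr
    · simpa [State.setNat, hreal] using h₇
  · rintro t s' ht ⟨-, h₂, -, h₄, h₅, h₆, h₇⟩
    exact hQ t s' ht h₂ h₄ ⟨h₅, fun g => h₆ g g.2, h₇⟩

/-- Compute the first thresholds of all agents. -/
def prepare : Program := .forTo 6 (.read 0 (.const 0)) (.seq askSingles raiseAll)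

theorem wp_prepare (v : Fin n → Finset (Fin m) → ℝ) {Q : ℕ → State → Prop}
    (hQ : ∀ t s, t ≤ n * (4 * (m * m) + 12 * m + 6) + 2 →
      (∀ a, a ≤ 2 → s.nat a = (initial n m).nat a) →
      (∀ i : Fin n, IsStart n (v i) (s.real 0 i)) → Q t s) :
    WP v prepare (initial n m) Q := by
  -- Array 3 is kept in the invariant because the next agent's single-item queries need it blank.
  refine wp_forTo (fun k s => s.nat 6 0 = k ∧ (∀ a, a ≤ 3 → s.nat a = (initial n m).nat a) ∧
    (∀ i : Fin n, (i : ℕ) < k → IsStart n (v i) (s.real 0 i)) ∧ ∀ j, k ≤ j → s.real 0 j = 0)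
    n (4 * (m * m) + 12 * m + 4) ?_ ?_ ?_ ?_
  · refine ⟨by simp [State.setNat], fun a ha => ?_, fun i hi => by omega, fun _ _ => rfl⟩
    have : a ≠ 6 := by omega
    simp [State.setNat, this]
  · rintro k s ⟨h₁, h₂, -⟩
    exact ⟨h₁, by simp [NExp.eval, h₂, initial]⟩
  · rintro k hk s ⟨h₁, h₂, h₃, h₄⟩
    obtain ⟨i, rfl⟩ : ∃ i : Fin n, k = i := ⟨⟨k, hk⟩, rfl⟩
    refine wp_seq (wp_askSingles (i := i) (by simp [h₂, initial]) h₁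
      (fun k => by simp [h₂, initial]) ?_)
    intro t₁ s₁ ht₁ n₁ r₁ x₁
    refine wp_raiseAll (i := i) (f := v i) (by simp [n₁, h₂, initial]) (by simp [n₁, h₂, initial])
      (by simp [n₁, h₁]) (by rw [r₁, h₄ _ le_rfl]) x₁ ?_
    intro t₂ s₂ ht₂ n₂ r₂ x₂
    refine ⟨?_, by simp [n₂, n₁, h₁], by simp [State.setNat], fun a ha => ?_, fun j hj => ?_,
      fun j hj => ?_⟩
    · have : m * (4 * m + 7) = 4 * (m * m) + 7 * m := by ring
      omega
    · have h6 : a ≠ 6 := by omega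
      have h7 : a ≠ 7 := by omega
      simp only [State.setNat, ne_eq, h6, not_false_eq_true, Function.update_of_ne]
      rw [n₂ a (by omega) (by omega) (by omega), n₁ a h7, h₂ a ha]
    · rcases Nat.lt_succ_iff_lt_or_eq.1 hj with h' | h'
      · simp only [State.setNat]
        rw [r₂ _ h'.ne, r₁]
        exact h₃ j h'
      · obtain rfl : j = i := Fin.ext h'
        exact x₂
    · simp only [State.setNat]
      rw [r₂ _ (by omega), r₁, h₄ _ (by omega)]
  · rintro t s ht ⟨-, h₂, h₃, -⟩
    exact hQ t s ht (fun a ha => h₂ a (by omega)) fun i => h₃ i i.2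

/-! ### The whole algorithm and its running time -/

/-- The algorithm. -/
def localSearch : Program :=
  .seq prepare <| .seq restart <| .while (.ltNat (.var 6) (.read 0 (.const 0)))
    (.seq evaluate choose)

theorem wp_localSearch (hn : 0 < n) (hv : ∀ i, IsValuation (v i)) :
    WP v localSearch (initial n m) fun t s =>
      t ≤ n * (4 * (m * m) + 12 * m + 6) + 5 +
        (80 * n * (m + 1) * ((n + 1) * (m + 2)) + n * (m + 2) + m) * (12 * m + 32) ∧
      ∃ A : Fin m → Fin n, (∀ j : Fin m, s.nat 1 j = A j) ∧
        ∀ i, 19 / 60 * mms n (v i) ≤ v i (bundle A i) := by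
  refine wp_seq (wp_prepare v ?_)
  intro t s ht hnat hstart
  refine wp_seq (wp_restart ?_)
  set s₀ := (s.setNat 6 0 0).setNat 7 0 0 with hs₀
  set τ₀ : Fin n → ℝ := fun i => s.real 0 i with hτ₀
  have hinv : Inv v τ₀ (fun _ : Fin m => (⟨0, hn⟩ : Fin n)) τ₀ ∅ := Inv.start hn hv hstart
  have h : LoopInv v τ₀ (80 * n * (m + 1) * ((n + 1) * (m + 2)) + n * (m + 2) + m) s₀ := by
    -- The budget is the range `4n` of the potential divided by the least improvement 1/(20(m+1)).
    refine ⟨_, τ₀, ∅, 80 * n * (m + 1), ⟨?_, ?_, ?_, ?_, fun i => rfl⟩, hinv, ?_, ?_, ?_, ?_, ?_, ?_⟩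
    · simp [hs₀, State.setNat, hnat, initial]
    · simp [hs₀, State.setNat, hnat, initial]
    · simp [hs₀, State.setNat, hnat, initial]
    · simp [hs₀, State.setNat, hnat, initial]
    · simp [hs₀, State.setNat]
    · simp [hs₀, State.setNat]
    · have := hinv.potential_nonneg hv
      have e : ((80 * n * (m + 1) : ℕ) : ℝ) * (1 / (20 * (m + 1))) = 4 * n := by
        push_cast
        field_simp
        norm_num
      linarith
    · simp [hs₀, State.setNat]
    · simp [hs₀, State.setNat]
    · simp [hs₀, State.setNat]
  refine (wp_while (LoopInv v τ₀) (12 * m + 31) ?_ h).mono ?_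
  · intro N s hI hb
    refine wp_body hn hv hstart hI ?_
    obtain ⟨A, τ, L, q, hrep, -⟩ := hI
    simpa [Test.Holds, NExp.eval, NExp.var, hrep.agents] using hb
  · rintro t' s' ⟨ht', hb, N, A, τ, L, q, hrep, hinv', -, -, -, hsat, -⟩
    simp only [Test.Holds, NExp.eval, NExp.var, hrep.agents, not_lt] at hb
    rw [show 12 * m + 31 + 1 = 12 * m + 32 from rfl] at ht'
    exact ⟨by omega, A, hrep.owner, hinv'.approx hv fun j => hsat j (j.2.trans_le hb)⟩

end program

end MMSAlloc

theorem mainTheorem7 :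
    (∃ (c : MMSAlloc.Program) (p : Polynomial ℕ) (ε : ℕ → ℝ),
      Tendsto ε atTop (𝓝 0) ∧
      ∀ (n m : ℕ), 0 < n →
      ∀ v : Fin n → Finset (Fin m) → ℝ, (∀ i, MMSAlloc.IsValuation (v i)) →
        ∃ (A : Fin m → Fin n) (t : ℕ),
          MMSAlloc.Outputs v c A t ∧ t ≤ p.eval (n + m) ∧
          ∀ i : Fin n,
            (1 / 2 : ℝ) * (1 - 1 / Real.exp 1 - ε m) * MMSAlloc.mms n (v i)
              ≤ v i (MMSAlloc.bundle A i)) ∧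
    |(1 / 2 : ℝ) * (1 - 1 / Real.exp 1) - 0.316| < 0.0005 := by
  -- Bounds on `e` that separate ½(1 − 1/e) from 19/60 and locate it near 0.316.
  have he₁ : (1 : ℝ) / Real.exp 1 < 1 / 2.7182818283 :=
    one_div_lt_one_div_of_lt (by norm_num) Real.exp_one_gt_d9
  have he₂ : (1 : ℝ) / 2.7182818286 < 1 / Real.exp 1 :=
    one_div_lt_one_div_of_lt (Real.exp_pos 1) Real.exp_one_lt_d9
  norm_num at he₁ he₂
  -- The polynomial is the step bound of `wp_localSearch` with both `n` and `m` replaced by `n + m`,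
  -- in which the bound is monotone; the error sequence is 0.
  refine ⟨⟨MMSAlloc.localSearch,
    .X * (4 * (.X * .X) + 12 * .X + 6) + 5 +
      (80 * .X * (.X + 1) * ((.X + 1) * (.X + 2)) + .X * (.X + 2) + .X) * (12 * .X + 32),
    fun _ => 0, tendsto_const_nhds, fun n m hn v hv => ?_⟩, ?_⟩
  · obtain ⟨t, s, hr, ht, A, hA, happ⟩ := MMSAlloc.wp_localSearch hn hv
    refine ⟨A, t, ⟨s, hr, hA⟩, ht.trans ?_, fun i => ?_⟩
    · have h₁ : n ≤ n + m := Nat.le_add_right _ _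
      have h₂ : m ≤ n + m := Nat.le_add_left _ _
      simp only [Polynomial.eval_add, Polynomial.eval_mul, Polynomial.eval_X,
        Polynomial.eval_ofNat, Polynomial.eval_one]
      gcongr
    · refine le_trans (mul_le_mul_of_nonneg_right ?_ (MMSAlloc.mms_nonneg hn (hv i))) (happ i)
      norm_num
      linarith
  · rw [abs_lt]
    norm_num
    constructor <;> linarith
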